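/- Let $S=\mathbb H^2/\Gamma$ be a complete orientable hyperbolic surface of finite area with $n\ge 1$ cusps $A_1,\dots,A_n$ (of any genus), and fix a horocycle, called canonical, at every cusp. Let $T$ be an ideal geodesic triangulation of $S$ with vertices at the cusps (loops, multiple edges and triangles with two edges glued together are allowed) and let $\mathbf r=(r_1,\dots,r_n)\in\mathbb R^n$. A semi-ideal prism is the (nondegenerate, i.e. three-dimensional) convex hull in $\mathbb H^3$ of an ideal triangle $A_iA_jA_h$ (the upper face) and its orthogonal projection $B_iB_jB_h$ (the lower face) to a plane that does not meet the triangle; each ideal vertex carries a horosphere, and the length of the lateral edge $A_iB_i$ is the signed distance from $B_i$ to the horosphere at $A_i$. The pair $(T,\mathbf r)$ is admissible if every triangle $A_iA_jA_h$ of $T$ is the upper face of a semi-ideal prism whose lateral edges at $A_i,A_j,A_h$, measured from the horospheres that extend the canonical horocycles, have lengths $r_i,r_j,r_h$. For an admissible pair, the prismatic complex $K(T,\mathbf r)$ is the metric space obtained by gluing these prisms along their lateral faces by the isometries that match the canonical horospheres; its metric is the quotient (gluing) metric, and the union of the upper faces, the upper boundary of $K(T,\mathbf r)$, is identified with $S$.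 The pair $(T,\mathbf r)$ is convex if it is admissible and if at every edge of $T$ the dihedral angles of the two prism sides adjacent to this upper edge have a sum of at most $\pi$. Two complexes $K',K''$ with upper boundary $S$ are marked isometric if there is an isometry $K'\to K''$ that maps upper boundary to upper boundary and induces on $S$ a self-isometry isotopic to the identity relative to the cusps. **Lemma.** If $(T',\mathbf r)$ and $(T'',\mathbf r)$ are two convex pairs on $S$ with the same weight vector $\mathbf r$, then the complexes $K(T',\mathbf r)$ and $K(T'',\mathbf r)$ are marked isometric. -/

import Mathlib

open scoped ENNReal NNReal Topology

noncomputable section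

namespace Prismatic

/-! ### Quotient (gluing) metrics -/

/-- Data for a quotient metric: points with an extended distance (`⊤` between different pieces)
and a relation telling which points are to be identified. -/
structure GluingData where
  Pt : Type
  d : Pt → Pt → ℝ≥0∞
  d_comm : ∀ p q, d p q = d q p
  rel : Pt → Pt → Prop

namespace GluingData

variable (G : GluingData)

/-- The glued space: the quotient by the equivalence relation generated by `rel`. -/
def Space : Type := Quot G.rel

def cls (p : G.Pt) : G.Space := Quot.mk G.rel p

/-- `G.Chain a c L`: there is a finite chain `p₁, q₁, p₂, q₂, …, pₖ, qₖ` of points with `p₁` in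
the class `a`, with `qᵢ` identified with `pᵢ₊₁`, with `qₖ` in the class `c`, and with
`L = d p₁ q₁ + … + d pₖ qₖ`. -/
inductive Chain : G.Space → G.Space → ℝ≥0∞ → Prop
  | nil (a : G.Space) : Chain a a 0
  | cons (p q : G.Pt) (c : G.Space) (L : ℝ≥0∞) (h : Chain (G.cls q) c L) :
      Chain (G.cls p) c (G.d p q + L)

variable {G}

theorem Chain.append {a b c : G.Space} {L M : ℝ≥0∞} (h : G.Chain a b L) (h' : G.Chain b c M) :
    G.Chain a c (L + M) := by
  induction h with
  | nil a => simpa using h'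
  | cons p q e L h ih =>
    rw [add_assoc]
    exact Chain.cons p q c _ (ih h')

theorem Chain.reverse {a b : G.Space} {L : ℝ≥0∞} (h : G.Chain a b L) : G.Chain b a L := by
  induction h with
  | nil a => exact Chain.nil a
  | cons p q e L h ih =>
    have h1 : G.Chain (G.cls q) (G.cls p) (G.d q p + 0) := Chain.cons q p _ 0 (Chain.nil _)
    have h2 := ih.append h1
    rwa [add_zero, G.d_comm q p, add_comm] at h2

/-- The quotient metric: the distance is the infimum of the lengths of chains. -/
instance : PseudoEMetricSpace G.Space where
  edist a b := sInf {L | G.Chain a b L}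
  edist_self a := le_antisymm (sInf_le (Chain.nil a)) bot_le
  edist_comm a b := by
    congr 1
    ext L
    exact ⟨Chain.reverse, Chain.reverse⟩
  edist_triangle a b c := by
    rw [ENNReal.sInf_add]
    refine le_iInf₂ fun L hL => ?_
    rw [add_comm, ENNReal.sInf_add]
    refine le_iInf₂ fun M hM => ?_
    rw [add_comm]
    exact sInf_le (Chain.append hL hM)

end GluingData

/-! ### The hyperboloid model -/

/-- The vector space underlying Minkowski space `ℝ^{1,3}`. -/
abbrev V : Type := Fin 4 → ℝ

/-- The Minkowski scalar product. -/
def mink (x y : V) : ℝ := -(x 0 * y 0) + x 1 * y 1 + x 2 * y 2 + x 3 * y 3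

theorem mink_comm (x y : V) : mink x y = mink y x := by
  unfold mink; ring

/-- The unit vector orthogonal to the hyperplane `ℝ^{1,2} = {x₃ = 0}`. -/
def e₃ : V := Pi.single 3 1

/-- Hyperbolic space. -/
def H3 : Set V := {x | mink x x = -1 ∧ 0 < x 0}

/-- The hyperbolic plane, as a totally geodesic plane of hyperbolic space. -/
def H2 : Set V := {x | x ∈ H3 ∧ x 3 = 0}

/-- The future light cone. A vector `l` in it stands for the horosphere
`{x ∈ H3 | mink x l = -1}`, and the ray of `l` for the ideal point at its centre. -/
def lightCone : Set V := {x | mink x x = 0 ∧ 0 < x 0}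

/-- The hyperbolic distance. -/
def hdist (x y : V) : ℝ := Real.arcosh (-mink x y)

/-- The signed distance from a point `x` to the horosphere of `l`, negative inside the
horoball. -/
def horoDist (l x : V) : ℝ := Real.log (-mink x l)

/-- The hyperbolic convex hull (in `H3`, without its ideal points) of a set of points of
`H3` and of ideal points. -/
def hyperHull (A : Set V) : Set V := H3 ∩ (PointedCone.hull ℝ A : Set V)

/-! ### Semi-ideal prisms -/

/-- The orthogonal projection of the ideal point of `l` to the hyperbolic plane with unit normal
`n`. -/
def foot (n l : V) : V :=
  (Real.sqrt (-mink (l - mink l n • n) (l - mink l n • n)))⁻¹ • (l - mink l n • n)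

/-- The prism with ideal upper vertices `Δ` over the plane with unit normal `n`. -/
def prism (n : V) (Δ : Set V) : Set V := hyperHull (Δ ∪ foot n '' Δ)

/-- The lateral face (a trapezoid) of a prism over the upper edge with endpoints `e`. -/
def lateralFace (n : V) (e : Set V) : Set V := hyperHull (e ∪ foot n '' e)

/-- `n` is a unit normal of the lower plane of a nondegenerate semi-ideal prism with upper
vertices `Δ`, all in the ideal boundary of `H2`: the plane has `Δ` on one side, and is not
orthogonal to `H2`. The sign of `n` is chosen such that `Δ` is on the negative side, and, after a
reflection in `H2`, the prism lies in `{x₃ ≥ 0}`. -/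
structure IsPrismNormal (Δ : Set V) (n : V) : Prop where
  unit : mink n n = 1
  pos : 0 < n 3
  side : ∀ v ∈ Δ, mink n v < 0

/-- `ν` is the outer unit normal of the lateral face over the edge `e` of the prism with upper
vertices `Δ` and lower plane with normal `n`: the plane orthogonal to `ν` contains the edge, is
orthogonal to the lower plane, and has the remaining vertex on its negative side. -/
structure IsLateralOuterNormal (Δ e : Set V) (n ν : V) : Prop where
  unit : mink ν ν = 1
  edge : ∀ v ∈ e, mink ν v = 0
  orth : mink ν n = 0
  side : ∀ v ∈ Δ \ e, mink ν v < 0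

/-- The interior dihedral angle of two faces of a polyhedron in `H3` with outer unit normals
`ν₁`, `ν₂`. -/
def dihedralAngle (ν₁ ν₂ : V) : ℝ := Real.pi - Real.arccos (mink ν₁ ν₂)

/-- Two points `x`, `y` of the lateral faces over the same upper edge `e` of two prisms
correspond to each other under an isometry of these faces that matches the horospheres at
both endpoints of the edge. -/
def LateralGlue (e : Set V) (n n' x y : V) : Prop :=
  ∃ ψ : lateralFace n e ≃ lateralFace n' e,
    (∀ p q, hdist (ψ p) (ψ q) = hdist p q) ∧
    (∀ p, ∀ v ∈ e, horoDist v (ψ p) = horoDist v p) ∧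
    ∃ hx : x ∈ lateralFace n e, (ψ ⟨x, hx⟩ : V) = y

/-! ### Cusp surfaces -/

/-- A complete orientable hyperbolic surface `H2 / Γ` of finite area with `n` cusps, together with
a horocycle (the canonical one) at every cusp. -/
structure CuspSurface (n : ℕ) where
  /-- The group of deck transformations, acting on `ℝ^{1,3}`. -/
  Γ : Subgroup (V ≃ₗ[ℝ] V)
  mink_map : ∀ γ ∈ Γ, ∀ x y, mink (γ x) (γ y) = mink x y
  map_e₃ : ∀ γ ∈ Γ, γ e₃ = e₃
  future : ∀ γ ∈ Γ, ∀ x ∈ H2, 0 < (γ x) 0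
  orientation : ∀ γ ∈ Γ, LinearMap.det (γ : V →ₗ[ℝ] V) = 1
  discrete : ∀ x ∈ H2, ∀ R : ℝ, {γ | γ ∈ Γ ∧ hdist x (γ x) ≤ R}.Finite
  free : ∀ γ ∈ Γ, ∀ x ∈ H2, γ x = x → γ = 1
  /-- One lift of the canonical horocycle at each cusp. -/
  horo : Fin n → V
  horo_mem : ∀ i, horo i ∈ lightCone ∧ horo i 3 = 0
  /-- The centre of `horo i` is a parabolic fixed point. -/
  parabolic : ∀ i, ∃ γ ∈ Γ, γ ≠ 1 ∧ γ (horo i) = horo i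
  /-- Different indices stand for different cusps, and the lift of the canonical horocycle to an
  ideal point is unique. -/
  inequivalent : ∀ i j, ∀ γ ∈ Γ, ∀ c : ℝ, γ (horo i) = c • horo j → i = j ∧ c = 1
  /-- The surface is the union of a compact set and of neighbourhoods of the cusps. -/
  cofinite : ∃ C : Set V, IsCompact C ∧ C ⊆ H2 ∧
    ∀ x ∈ H2, ∃ γ ∈ Γ, γ x ∈ C ∨ ∃ i, horoDist (horo i) (γ x) ≤ 0

namespace CuspSurface

variable {n : ℕ} (S : CuspSurface n)

/-- The surface `H2 / Γ` with its quotient metric. -/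
def surfaceData : GluingData where
  Pt := H2
  d p q := ENNReal.ofReal (hdist p q)
  d_comm p q := by simp only [hdist, mink_comm]
  rel p q := ∃ γ ∈ S.Γ, γ (p : V) = q

def Surface : Type := S.surfaceData.Space

instance : PseudoEMetricSpace S.Surface :=
  inferInstanceAs (PseudoEMetricSpace S.surfaceData.Space)

def proj (x : H2) : S.Surface := S.surfaceData.cls x

/-- The filter of neighbourhoods of the `i`-th cusp. -/
def cuspFilter (i : Fin n) : Filter S.Surface :=
  Filter.map S.proj (Filter.comap (fun x : H2 => mink x (S.horo i)) (𝓝 0))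

/-- A self-isometry of the surface is isotopic to the identity through homeomorphisms that fix
every cusp. -/
def IsotopicToId (f : S.Surface ≃ᵢ S.Surface) : Prop :=
  ∃ F : unitInterval → (S.Surface ≃ₜ S.Surface),
    Continuous (fun p : unitInterval × S.Surface => F p.1 p.2) ∧
    (∀ t i, Filter.Tendsto (F t) (S.cuspFilter i) (S.cuspFilter i)) ∧
    (∀ s, F 0 s = s) ∧ (∀ s, F 1 s = f s)

/-- `v` is a lift of the canonical horocycle at the `i`-th cusp. -/
def IsLift (i : Fin n) (v : V) : Prop := ∃ γ ∈ S.Γ, v = γ (S.horo i)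

/-- `m` is the normal of the lower plane of a semi-ideal prism with upper face `Δ` whose lateral
edge at each vertex, measured from the canonical horosphere, has the weight of the cusp as its
length. -/
def IsPrismOver (r : Fin n → ℝ) (Δ : Set V) (m : V) : Prop :=
  IsPrismNormal Δ m ∧ ∀ v ∈ Δ, ∀ i, S.IsLift i v → horoDist v (foot m v) = r i

/-- An ideal geodesic triangulation of the surface with vertices at the cusps, given by its
lift to `H2`. A triangle is given by the set of the canonical horocycles at its ideal
vertices. -/
structure Triangulation where
  faces : Set (Set V)
  card : ∀ Δ ∈ faces, Δ.ncard = 3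
  lift : ∀ Δ ∈ faces, ∀ v ∈ Δ, ∃ i, S.IsLift i v
  invariant : ∀ γ ∈ S.Γ, ∀ Δ ∈ faces, γ '' Δ ∈ faces
  finite : ∃ F : Set (Set V), F.Finite ∧ F ⊆ faces ∧ ∀ Δ ∈ faces, ∃ γ ∈ S.Γ, ∃ Δ₀ ∈ F, Δ = γ '' Δ₀
  cover : ∀ x ∈ H2, ∃ Δ ∈ faces, x ∈ hyperHull Δ
  /-- Two different triangles meet at most in a common edge. -/
  inter : ∀ Δ ∈ faces, ∀ Δ' ∈ faces, hyperHull Δ ∩ hyperHull Δ' ⊆ hyperHull (Δ ∩ Δ')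

namespace Triangulation

variable {S} (T : S.Triangulation)

/-- The pair `(T, r)` is admissible: every triangle is the upper face of a semi-ideal prism with
lateral edges of the lengths given by the weights. -/
def Admissible (r : Fin n → ℝ) : Prop := ∀ Δ ∈ T.faces, ∃ m, S.IsPrismOver r Δ m

variable {T} {r : Fin n → ℝ}

/-- The normal of the lower plane of the prism over a triangle. -/
def Admissible.normal (h : T.Admissible r) (Δ : T.faces) : V := (h Δ Δ.2).choose

/-- A point of the disjoint union of all prisms. -/
structure Admissible.Point (h : T.Admissible r) : Type where
  face : T.faces
  pt : V
  mem : pt ∈ prism (h.normal face) face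

/-- The identifications: by deck transformations (so that there is one prism for each triangle of
the surface), and by the gluing isometries of lateral faces of adjacent prisms. -/
inductive Admissible.Glue (h : T.Admissible r) : h.Point → h.Point → Prop
  | deck (p q : h.Point) (γ : V ≃ₗ[ℝ] V) (hγ : γ ∈ S.Γ)
      (hface : (q.face : Set V) = γ '' (p.face : Set V)) (hpt : q.pt = γ p.pt) : Glue h p q
  | lateral (p q : h.Point) (hne : p.face ≠ q.face) (e : Set V) (he : e.ncard = 2)
      (hp : e ⊆ p.face) (hq : e ⊆ q.face)
      (hpt : LateralGlue e (h.normal p.face) (h.normal q.face) p.pt q.pt) : Glue h p q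

open Classical in
/-- The prisms with their hyperbolic metrics, and the identifications. -/
def Admissible.data (h : T.Admissible r) : GluingData where
  Pt := h.Point
  d p q := if p.face = q.face then ENNReal.ofReal (hdist p.pt q.pt) else ⊤
  d_comm p q := by simp only [hdist, mink_comm, eq_comm]
  rel := h.Glue

/-- The prismatic complex `K(T, r)`, a metric space. -/
def Admissible.Complex (h : T.Admissible r) : Type := h.data.Space

instance (h : T.Admissible r) : PseudoEMetricSpace h.Complex :=
  inferInstanceAs (PseudoEMetricSpace h.data.Space)

/-- The point of the complex represented by a point of a prism. -/
def Admissible.toComplex (h : T.Admissible r) (p : h.Point) : h.Complex := h.data.cls p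

/-- The identification of the surface with the upper boundary of the complex, as a relation:
`k` is the point of the upper boundary that corresponds to the point `s` of the surface. -/
def Admissible.IsUpperPoint (h : T.Admissible r) (s : S.Surface) (k : h.Complex) : Prop :=
  ∃ (x : H2) (p : h.Point), (x : V) ∈ hyperHull (p.face : Set V) ∧ p.pt = x ∧
    S.proj x = s ∧ h.toComplex p = k

variable (T r)

/-- The pair `(T, r)` is convex: it is admissible, and at each upper edge `e` the dihedral angles
of the two adjacent prisms (between the upper face, with outer normal `-e₃`, and the lateral face
over `e`) have a sum of at most `π`. -/
structure IsConvexPair : Prop where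
  admissible : T.Admissible r
  convex : ∀ Δ Δ' : T.faces, Δ ≠ Δ' → ∀ e : Set V, e.ncard = 2 → e ⊆ Δ → e ⊆ Δ' →
    ∀ ν ν', IsLateralOuterNormal Δ e (admissible.normal Δ) ν →
      IsLateralOuterNormal Δ' e (admissible.normal Δ') ν' →
      dihedralAngle (-e₃) ν + dihedralAngle (-e₃) ν' ≤ Real.pi

variable {T r}

/-- Two complexes with upper boundary `S` are marked isometric: there is an isometry that induces
on `S` a self-isometry isotopic to the identity with respect to the cusps. -/
def MarkedIsometric {T' T'' : S.Triangulation} {r' r'' : Fin n → ℝ} (h' : T'.Admissible r')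
    (h'' : T''.Admissible r'') : Prop :=
  ∃ (Φ : h'.Complex ≃ᵢ h''.Complex) (f : S.Surface ≃ᵢ S.Surface), S.IsotopicToId f ∧
    ∀ s k' k'', h'.IsUpperPoint s k' → h''.IsUpperPoint (f s) k'' → Φ k' = k''

end Triangulation

end CuspSurface

end Prismatic

end

/-! A lift of a canonical horocycle is a light vector `v` in `ℝ^{1,2}`. If `m` is the unit normal of
the lower plane of a prism, the lateral edge at `v` has length `log (-mink m v)`. Hence the weights
prescribe the linear function `-mink m` on the cone over a triangle: its value at a vertex over the
`i`-th cusp is `exp (r i)`. An admissible pair thus gives a piecewise linear function on the open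
future cone of `ℝ^{1,2}`.

The condition on the dihedral angles says that this function is concave across each edge
(`IsConvexPair.local_support`), hence it is the minimum of its linear pieces
(`IsConvexPair.support`), and in the limit each piece is at least `exp (r i)` at every lift
(`IsConvexPair.support_lift`). For two convex pairs with the same weights, each piece of one
function therefore bounds the other function at the vertices of its triangles, hence on their cones.
By symmetry the two functions coincide (`IsConvexPair.mink_normal_eq`).

As `mink m m = 1` and `0 < m 3`, the normal is recovered from its linear function, so every point
`u` of a triangle of one pair lies in a triangle of the other pair with the same normal
(`IsConvexPair.exists_same_normal`). Each point of a prism is uniquely `u + s • m` with `u` in the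
cone of the upper face, and all gluings preserve `(u, s)` up to deck transformations. Equality of
coordinates defines a bijection of the complexes that is the identity on the surface. It is an
isometry because a segment in one prism is covered locally by prisms of the other complex with the
same normal (`IsConvexPair.edist_le`).

Infinitely many lifted triangles meet at an ideal vertex. There local finiteness is replaced by the
uniform separation of the lifts (`exists_separation`), which forces the triangles that reach deep
into a horoball to have a vertex at its centre (`exists_depth`). -/

namespace Prismatic

/-! ### Minkowski space -/

theorem mink_add_left (x y z : V) : mink (x + y) z = mink x z + mink y z := by
  simp only [mink, Pi.add_apply]; ring

theorem mink_add_right (x y z : V) : mink x (y + z) = mink x y + mink x z := by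
  simp only [mink, Pi.add_apply]; ring

theorem mink_sub_left (x y z : V) : mink (x - y) z = mink x z - mink y z := by
  simp only [mink, Pi.sub_apply]; ring

theorem mink_sub_right (x y z : V) : mink x (y - z) = mink x y - mink x z := by
  simp only [mink, Pi.sub_apply]; ring

theorem mink_smul_left (c : ℝ) (x y : V) : mink (c • x) y = c * mink x y := by
  simp only [mink, Pi.smul_apply, smul_eq_mul]; ring

theorem mink_smul_right (c : ℝ) (x y : V) : mink x (c • y) = c * mink x y := by
  simp only [mink, Pi.smul_apply, smul_eq_mul]; ring

theorem mink_zero_left (x : V) : mink 0 x = 0 := by simp [mink]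

theorem mink_zero_right (x : V) : mink x 0 = 0 := by simp [mink]

theorem mink_neg_left (x y : V) : mink (-x) y = -mink x y := by
  simp only [mink, Pi.neg_apply]; ring

theorem mink_neg_right (x y : V) : mink x (-y) = -mink x y := by
  simp only [mink, Pi.neg_apply]; ring

theorem mink_e₃_right (x : V) : mink x e₃ = x 3 := by simp [mink, e₃]

theorem mink_e₃_left (x : V) : mink e₃ x = x 3 := by simp [mink, e₃]

theorem continuous_mink_right (m : V) : Continuous fun x : V => mink m x := by
  unfold mink; fun_prop

theorem vec_ext {x y : V} (h0 : x 0 = y 0) (h1 : x 1 = y 1) (h2 : x 2 = y 2) (h3 : x 3 = y 3) :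
    x = y := by
  funext i; fin_cases i <;> assumption

/-! ### Causal vectors in `ℝ^{1,2}` -/

/-- Future timelike or lightlike vectors of `ℝ^{1,2}`, including zero. -/
structure Causal (x : V) : Prop where
  flat : x 3 = 0
  nonneg : 0 ≤ x 0
  le : mink x x ≤ 0

/-- Future timelike vectors of `ℝ^{1,2}`. -/
structure Timelike (x : V) : Prop where
  flat : x 3 = 0
  pos : 0 < x 0
  neg : mink x x < 0

/-- Future lightlike vectors of `ℝ^{1,2}`. -/
structure Null (x : V) : Prop where
  flat : x 3 = 0
  pos : 0 < x 0
  self : mink x x = 0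

theorem Timelike.causal {x : V} (h : Timelike x) : Causal x := ⟨h.flat, h.pos.le, h.neg.le⟩

theorem Null.causal {x : V} (h : Null x) : Causal x := ⟨h.flat, h.pos.le, h.self.le⟩

theorem Causal.zero : Causal 0 := ⟨rfl, le_rfl, (mink_zero_left 0).le⟩

/-- Reversed Cauchy–Schwarz: the spatial parts are no longer than the time components. -/
theorem Causal.mink_nonpos {x y : V} (hx : Causal x) (hy : Causal y) : mink x y ≤ 0 := by
  obtain ⟨hx3, hx0, hx⟩ := hx
  obtain ⟨hy3, hy0, hy⟩ := hy
  simp only [mink, hx3, hy3] at *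
  have h1 : (x 1 * y 1 + x 2 * y 2) ^ 2 ≤ (x 0 * y 0) ^ 2 := by
    have h2 : (x 1 ^ 2 + x 2 ^ 2) * (y 1 ^ 2 + y 2 ^ 2) ≤ x 0 ^ 2 * y 0 ^ 2 := by
      apply mul_le_mul <;> nlinarith [sq_nonneg (x 0), sq_nonneg (y 1), sq_nonneg (y 2)]
    nlinarith [sq_nonneg (x 1 * y 2 - x 2 * y 1)]
  have h2 := abs_le_of_sq_le_sq h1 (mul_nonneg hx0 hy0)
  linarith [le_abs_self (x 1 * y 1 + x 2 * y 2)]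

theorem Causal.add {x y : V} (hx : Causal x) (hy : Causal y) : Causal (x + y) := by
  refine ⟨by simp [hx.flat, hy.flat], add_nonneg hx.nonneg hy.nonneg, ?_⟩
  have := hx.mink_nonpos hy
  rw [mink_add_left, mink_add_right, mink_add_right, mink_comm y x]
  linarith [hx.le, hy.le]

theorem Causal.smul {x : V} (hx : Causal x) {c : ℝ} (hc : 0 ≤ c) : Causal (c • x) := by
  refine ⟨by simp [hx.flat], mul_nonneg hc hx.nonneg, ?_⟩
  rw [mink_smul_left, mink_smul_right]
  nlinarith [hx.le, mul_nonneg hc hc]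

theorem Timelike.add_causal {x y : V} (hx : Timelike x) (hy : Causal y) : Timelike (x + y) := by
  refine ⟨by simp [hx.flat, hy.flat], add_pos_of_pos_of_nonneg hx.pos hy.nonneg, ?_⟩
  have := hx.causal.mink_nonpos hy
  rw [mink_add_left, mink_add_right, mink_add_right, mink_comm y x]
  linarith [hx.neg, hy.le]

theorem Timelike.smul {x : V} (hx : Timelike x) {c : ℝ} (hc : 0 < c) : Timelike (c • x) := by
  refine ⟨by simp [hx.flat], mul_pos hc hx.pos, ?_⟩
  rw [mink_smul_left, mink_smul_right]
  nlinarith [hx.neg, mul_pos hc hc]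

theorem Causal.eq_zero {x : V} (hx : Causal x) (h : x 0 = 0) : x = 0 := by
  have := hx.le
  simp only [mink, hx.flat, h] at this
  apply vec_ext h _ _ hx.flat <;> simp only [Pi.zero_apply] <;>
    nlinarith [sq_nonneg (x 1), sq_nonneg (x 2)]

theorem Causal.timelike_or_null {x : V} (hx : Causal x) (h : x ≠ 0) : Timelike x ∨ Null x := by
  have h0 : 0 < x 0 := lt_of_le_of_ne hx.nonneg fun h0 => h (hx.eq_zero h0.symm)
  rcases hx.le.lt_or_eq with h1 | h1
  · exact .inl ⟨hx.flat, h0, h1⟩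
  · exact .inr ⟨hx.flat, h0, h1⟩

/-- A vector orthogonal to a timelike vector is spacelike or zero. -/
theorem eq_zero_of_mink_timelike {t x : V} (ht : Timelike t) (h : mink t x = 0)
    (hx : mink x x ≤ 0) : x = 0 := by
  obtain ⟨t3, t0, ht⟩ := ht
  simp only [mink, t3] at *
  have h1 : (t 0 * x 0) ^ 2 ≤ (t 1 ^ 2 + t 2 ^ 2) * (x 1 ^ 2 + x 2 ^ 2) := by
    have : t 0 * x 0 = t 1 * x 1 + t 2 * x 2 := by linarith
    rw [this]; nlinarith [sq_nonneg (t 1 * x 2 - t 2 * x 1)]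
  have h2 : x 1 ^ 2 + x 2 ^ 2 + x 3 ^ 2 ≤ x 0 ^ 2 := by nlinarith
  set T := t 1 ^ 2 + t 2 ^ 2 with hT
  have hT0 : 0 ≤ T := by positivity
  have hT1 : 0 < t 0 ^ 2 - T := by nlinarith
  have h3 : (t 0 ^ 2 - T) * x 0 ^ 2 ≤ 0 := by
    nlinarith [mul_le_mul_of_nonneg_left h2 hT0, mul_nonneg hT0 (sq_nonneg (x 3))]
  have h4 : x 0 ^ 2 = 0 := by
    apply le_antisymm _ (sq_nonneg _)
    by_contra h
    push Not at h
    nlinarith [mul_pos hT1 h]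
  have h5 : x 0 = 0 := by simpa using h4
  have e1 : x 1 ^ 2 = 0 := by nlinarith [sq_nonneg (x 1), sq_nonneg (x 2), sq_nonneg (x 3)]
  have e2 : x 2 ^ 2 = 0 := by nlinarith [sq_nonneg (x 1), sq_nonneg (x 2), sq_nonneg (x 3)]
  have e3 : x 3 ^ 2 = 0 := by nlinarith [sq_nonneg (x 1), sq_nonneg (x 2), sq_nonneg (x 3)]
  exact vec_ext h5 (by simpa using e1) (by simpa using e2) (by simpa using e3)

theorem Timelike.mink_neg_of_causal {x y : V} (hx : Timelike x) (hy : Causal y) (hne : y ≠ 0) :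
    mink x y < 0 := by
  rcases (hx.causal.mink_nonpos hy).lt_or_eq with h | h
  · exact h
  · exact absurd (eq_zero_of_mink_timelike hx h hy.le) hne

theorem Null.ne_zero {x : V} (h : Null x) : x ≠ 0 := fun h0 => by
  have := h.pos; simp [h0] at this

theorem Timelike.ne_zero {x : V} (h : Timelike x) : x ≠ 0 := fun h0 => by
  have := h.pos; simp [h0] at this

theorem Null.proportional {v w : V} (hv : Null v) (hw : Null w) (h : mink v w = 0) :
    w = (w 0 / v 0) • v := by
  obtain ⟨v3, v0, hv⟩ := hv
  obtain ⟨w3, w0, hw⟩ := hw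
  simp only [mink, v3, w3] at hv hw h
  have h1 : (v 0 * w 1 - w 0 * v 1) ^ 2 + (v 0 * w 2 - w 0 * v 2) ^ 2 = 0 := by
    linear_combination v 0 ^ 2 * hw - 2 * v 0 * w 0 * h + w 0 ^ 2 * hv
  have h2 : v 0 * w 1 - w 0 * v 1 = 0 := by
    nlinarith [sq_nonneg (v 0 * w 1 - w 0 * v 1), sq_nonneg (v 0 * w 2 - w 0 * v 2)]
  have h3 : v 0 * w 2 - w 0 * v 2 = 0 := by
    nlinarith [sq_nonneg (v 0 * w 1 - w 0 * v 1), sq_nonneg (v 0 * w 2 - w 0 * v 2)]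
  apply vec_ext <;> simp only [Pi.smul_apply, smul_eq_mul, v3, w3] <;> field_simp <;> linarith

/-- A causal vector that is not orthogonal to a lightlike vector has a timelike sum with it. -/
theorem Causal.add_timelike {x y : V} (hx : Causal x) (hy : Causal y) (h : mink x y < 0) :
    Timelike (x + y) := by
  refine ⟨(hx.add hy).flat, ?_, ?_⟩
  · refine lt_of_le_of_ne (hx.add hy).nonneg fun h0 => ?_
    have hx0 : x 0 = 0 := by
      have := hx.nonneg; have := hy.nonneg; simp only [Pi.add_apply] at h0; linarith
    rw [hx.eq_zero hx0, mink_zero_left] at h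
    exact lt_irrefl _ h
  · rw [mink_add_left, mink_add_right, mink_add_right, mink_comm y x]
    linarith [hx.le, hy.le]

/-! ### Determinants and Cramer's rule in `ℝ^{1,2}` -/

/-- The determinant of the components in `ℝ^{1,2}`. -/
def det3 (x y z : V) : ℝ :=
  x 0 * (y 1 * z 2 - y 2 * z 1) - x 1 * (y 0 * z 2 - y 2 * z 0) + x 2 * (y 0 * z 1 - y 1 * z 0)

/-- This is the Gram determinant, with the sign of the Lorentzian form. It reduces linear
independence to the values of `mink`. -/
theorem det3_sq (x y z : V) (hx : x 3 = 0) (hy : y 3 = 0) (hz : z 3 = 0) :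
    det3 x y z ^ 2 = -(mink x x * (mink y y * mink z z - mink y z ^ 2)
      - mink x y * (mink x y * mink z z - mink y z * mink x z)
      + mink x z * (mink x y * mink y z - mink y y * mink x z)) := by
  simp only [det3, mink, hx, hy, hz]; ring

/-- A vector orthogonal to three independent vectors of `ℝ^{1,2}` has no component there. -/
theorem eq_zero_of_det3 {x y z d : V} (hx : x 3 = 0) (hy : y 3 = 0) (hz : z 3 = 0)
    (hD : det3 x y z ≠ 0) (h1 : mink d x = 0) (h2 : mink d y = 0) (h3 : mink d z = 0) :
    d 0 = 0 ∧ d 1 = 0 ∧ d 2 = 0 := by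
  simp only [mink, hx, hy, hz] at h1 h2 h3
  refine ⟨?_, ?_, ?_⟩ <;> refine (mul_eq_zero.1 ?_).resolve_left hD
  · simp only [det3]
    linear_combination -(y 1 * z 2 - y 2 * z 1) * h1 + (x 1 * z 2 - x 2 * z 1) * h2 -
      (x 1 * y 2 - x 2 * y 1) * h3
  · simp only [det3]
    linear_combination -(y 0 * z 2 - y 2 * z 0) * h1 + (x 0 * z 2 - x 2 * z 0) * h2 -
      (x 0 * y 2 - x 2 * y 0) * h3
  · simp only [det3]
    linear_combination (y 0 * z 1 - y 1 * z 0) * h1 - (x 0 * z 1 - x 1 * z 0) * h2 +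
      (x 0 * y 1 - x 1 * y 0) * h3

theorem cramer (x y z d : V) (hx : x 3 = 0) (hy : y 3 = 0) (hz : z 3 = 0) (hd : d 3 = 0) :
    det3 x y z • d = det3 d y z • x + det3 x d z • y + det3 x y d • z := by
  apply vec_ext <;> simp only [Pi.smul_apply, Pi.add_apply, smul_eq_mul, hx, hy, hz, hd, det3] <;>
    ring

/-- The Lorentzian cross product of the components in `ℝ^{1,2}`. -/
def cross (x y : V) : V :=
  ![-(x 1 * y 2 - x 2 * y 1), -(x 0 * y 2 - x 2 * y 0), x 0 * y 1 - x 1 * y 0, 0]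

theorem cross_flat (x y : V) : cross x y 3 = 0 := rfl

theorem mink_cross (x y z : V) : mink (cross x y) z = det3 x y z := by
  simp [mink, cross, det3]; ring

theorem mink_cross_left (x y : V) : mink (cross x y) x = 0 := by
  rw [mink_cross]; simp only [det3]; ring

theorem mink_cross_right (x y : V) : mink (cross x y) y = 0 := by
  rw [mink_cross]; simp only [det3]; ring

theorem mink_cross_self {x y : V} (hx : Null x) (hy : Null y) :
    mink (cross x y) (cross x y) = mink x y ^ 2 := by
  have e : mink (cross x y) (cross x y) = mink x y ^ 2 - mink x x * mink y y := by
    simp only [mink, hx.flat, hy.flat]; simp [cross]; ring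
  rw [e, hx.self]; ring

theorem det3_ne_zero {x y z : V} (hx : Null x) (hy : Null y) (hz : Null z) (hxy : mink x y < 0)
    (hxz : mink x z < 0) (hyz : mink y z < 0) : det3 x y z ≠ 0 := by
  intro h
  have := det3_sq x y z hx.flat hy.flat hz.flat
  rw [h, hx.self, hy.self, hz.self] at this
  have h1 : mink x y * mink x z * mink y z < 0 :=
    mul_neg_of_pos_of_neg (mul_pos_of_neg_of_neg hxy hxz) hyz
  nlinarith

/-- Two different lightlike directions have a common unit normal in `ℝ^{1,2}`. -/
theorem exists_unit_normal {x y : V} (hx : Null x) (hy : Null y) (hxy : mink x y < 0) :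
    ∃ b : V, b 3 = 0 ∧ mink b b = 1 ∧ mink b x = 0 ∧ mink b y = 0 := by
  have hne := hxy.ne
  refine ⟨(mink x y)⁻¹ • cross x y, by simp [cross_flat], ?_, ?_, ?_⟩
  · rw [mink_smul_left, mink_smul_right, mink_cross_self hx hy]; field_simp
  · rw [mink_smul_left, mink_cross_left, mul_zero]
  · rw [mink_smul_left, mink_cross_right, mul_zero]

/-- Expansion in the basis given by two lightlike vectors and their common unit normal. -/
theorem expand_null {v w b x : V} (hv : Null v) (hw : Null w) (hvw : mink v w < 0) (hb : b 3 = 0)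
    (hbb : mink b b = 1) (hbv : mink b v = 0) (hbw : mink b w = 0) (hx : x 3 = 0) :
    x = (mink x w / mink v w) • v + (mink x v / mink v w) • w + mink x b • b := by
  have hne := hvw.ne
  have hD : det3 v w b ≠ 0 := by
    intro h
    have := det3_sq v w b hv.flat hw.flat hb
    rw [h, hv.self, hw.self, hbb, mink_comm v b, hbv, mink_comm w b, hbw] at this
    have : 0 < mink v w ^ 2 := by nlinarith
    nlinarith
  rw [← sub_eq_zero]
  obtain ⟨h0, h1, h2⟩ := eq_zero_of_det3
    (d := x - ((mink x w / mink v w) • v + (mink x v / mink v w) • w + mink x b • b))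
    hv.flat hw.flat hb hD
    (by simp only [mink_sub_left, mink_add_left, mink_smul_left, hv.self, hbv, mink_comm w v]
        field_simp; ring)
    (by simp only [mink_sub_left, mink_add_left, mink_smul_left, hw.self, hbw]
        field_simp; ring)
    (by simp only [mink_sub_left, mink_add_left, mink_smul_left, mink_comm v b, hbv,
          mink_comm w b, hbw, hbb]; ring)
  exact vec_ext h0 h1 h2 (by simp [hx, hv.flat, hw.flat, hb])

theorem mem_H2_iff {x : V} : x ∈ H2 ↔ Timelike x ∧ mink x x = -1 :=
  ⟨fun h => ⟨⟨h.2, h.1.2, by rw [h.1.1]; norm_num⟩, h.1.1⟩, fun h => ⟨⟨h.2, h.1.pos⟩, h.1.flat⟩⟩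

theorem Timelike.exists_smul_mem_H2 {x : V} (h : Timelike x) : ∃ c : ℝ, 0 < c ∧ c • x ∈ H2 := by
  have h1 : 0 < -mink x x := by linarith [h.neg]
  have hc : 0 < (Real.sqrt (-mink x x))⁻¹ := inv_pos.2 (Real.sqrt_pos.2 h1)
  refine ⟨_, hc, mem_H2_iff.2 ⟨h.smul hc, ?_⟩⟩
  rw [mink_smul_left, mink_smul_right, ← mul_assoc, ← mul_inv, Real.mul_self_sqrt h1.le,
    inv_neg, neg_mul, inv_mul_cancel₀ h.neg.ne]

/-! ### Deck transformations, parabolic shears and the separation of the lifts -/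

namespace CuspSurface

variable {n : ℕ} {S : CuspSurface n}

theorem inv_apply_apply (γ : V ≃ₗ[ℝ] V) (x : V) : γ⁻¹ (γ x) = x := γ.symm_apply_apply x

theorem apply_inv_apply (γ : V ≃ₗ[ℝ] V) (x : V) : γ (γ⁻¹ x) = x := γ.apply_symm_apply x

theorem apply_flat {γ : V ≃ₗ[ℝ] V} (hγ : γ ∈ S.Γ) (x : V) : γ x 3 = x 3 := by
  rw [← mink_e₃_right (γ x), ← mink_e₃_right x, ← S.mink_map γ hγ x e₃, S.map_e₃ γ hγ]

theorem apply_timelike {γ : V ≃ₗ[ℝ] V} (hγ : γ ∈ S.Γ) {x : V} (hx : Timelike x) :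
    Timelike (γ x) := by
  obtain ⟨c, hc, h⟩ := hx.exists_smul_mem_H2
  have h1 := S.future γ hγ _ h
  rw [map_smul, Pi.smul_apply, smul_eq_mul] at h1
  exact ⟨by rw [apply_flat hγ, hx.flat], pos_of_mul_pos_right h1 hc.le,
    by rw [S.mink_map γ hγ]; exact hx.neg⟩

theorem timelike_single : Timelike (Pi.single 0 1 : V) := by
  refine ⟨by simp, by simp, by simp [mink]⟩

theorem apply_null {γ : V ≃ₗ[ℝ] V} (hγ : γ ∈ S.Γ) {v : V} (hv : Null v) : Null (γ v) := by
  have h3 : γ v 3 = 0 := by rw [apply_flat hγ, hv.flat]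
  have hs : mink (γ v) (γ v) = 0 := by rw [S.mink_map γ hγ, hv.self]
  refine ⟨h3, ?_, hs⟩
  -- Otherwise `-γ v` is causal and pairs with the image of a timelike vector with the wrong sign.
  by_contra h0
  have h1 : Causal (-γ v) := ⟨by simp [h3], by simpa using h0,
    by simp [mink_neg_left, mink_neg_right, hs]⟩
  have h2 := (apply_timelike hγ timelike_single).causal.mink_nonpos h1
  have h3 := timelike_single.mink_neg_of_causal hv.causal hv.ne_zero
  rw [mink_neg_right, S.mink_map γ hγ] at h2
  linarith

theorem eq_one_of_fixes {γ : V ≃ₗ[ℝ] V} (hγ : γ ∈ S.Γ) {x : V} (h3 : x 3 = 0)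
    (hx : mink x x < 0) (h : γ x = x) : γ = 1 := by
  have key : ∀ y : V, Timelike y → γ y = y → γ = 1 := fun y hy h => by
    obtain ⟨c, hc, hc2⟩ := hy.exists_smul_mem_H2
    exact S.free γ hγ _ hc2 (by rw [map_smul, h])
  rcases lt_trichotomy (x 0) 0 with h0 | h0 | h0
  · exact key (-x) ⟨by simp [h3], by simpa using h0, by simpa [mink_neg_left, mink_neg_right]⟩
      (by rw [map_neg, h])
  · simp only [mink, h0, h3] at hx
    nlinarith [sq_nonneg (x 1), sq_nonneg (x 2)]
  · exact key x ⟨h3, h0, hx⟩ h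

theorem horo_null (i : Fin n) : Null (S.horo i) :=
  ⟨(S.horo_mem i).2, (S.horo_mem i).1.2, (S.horo_mem i).1.1⟩

theorem IsLift.null {i : Fin n} {v : V} (h : S.IsLift i v) : Null v := by
  obtain ⟨γ, hγ, rfl⟩ := h
  exact apply_null hγ (horo_null i)

theorem IsLift.apply {i : Fin n} {v : V} (h : S.IsLift i v) {γ : V ≃ₗ[ℝ] V} (hγ : γ ∈ S.Γ) :
    S.IsLift i (γ v) := by
  obtain ⟨γ', hγ', rfl⟩ := h
  exact ⟨γ * γ', mul_mem hγ hγ', rfl⟩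

/-- The field `inequivalent` fixes the scale, so an ideal point carries at most one lift, and
different lifts have different directions. -/
theorem IsLift.eq_of_smul {i j : Fin n} {v w : V} (hv : S.IsLift i v) (hw : S.IsLift j w) {c : ℝ}
    (h : w = c • v) : v = w := by
  obtain ⟨γ, hγ, rfl⟩ := hv
  obtain ⟨γ', hγ', rfl⟩ := hw
  have := S.inequivalent j i (γ⁻¹ * γ') (mul_mem (inv_mem hγ) hγ') c (by
    change γ⁻¹ (γ' (S.horo j)) = _
    rw [h, map_smul, inv_apply_apply])
  rw [h, this.2, one_smul]

theorem IsLift.mink_neg {i j : Fin n} {v w : V} (hv : S.IsLift i v) (hw : S.IsLift j w)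
    (hne : v ≠ w) : mink v w < 0 := by
  rcases (hv.null.causal.mink_nonpos hw.null.causal).lt_or_eq with h | h
  · exact h
  · exact absurd (hv.eq_of_smul hw (hv.null.proportional hw.null h)) hne

/-- A Lorentz transformation that fixes a lightlike vector `v` and shears its unit normal `b`
acts on the opposite lightlike vector as a parabolic transformation. -/
theorem shear_apply {P : V ≃ₗ[ℝ] V} (hP : P ∈ S.Γ) {v w b : V} (hv : Null v) (hw : Null w)
    (hvw : mink v w < 0) (hb : b 3 = 0) (hbb : mink b b = 1) (hbv : mink b v = 0)
    (hbw : mink b w = 0) (hPv : P v = v) {ε k : ℝ} (hε : ε ^ 2 = 1)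
    (hPb : P b = ε • b + k • v) :
    P w = w + (-(ε * mink v w * k)) • b + (-(mink v w * k ^ 2 / 2)) • v := by
  have hne := hvw.ne
  have e := expand_null hv hw hvw hb hbb hbv hbw (x := P w) (by rw [apply_flat hP, hw.flat])
  have h1 : mink (P w) v = mink v w := by
    conv_lhs => rw [← hPv]
    rw [S.mink_map P hP, mink_comm]
  have h2 : mink (P w) b = -(ε * mink v w * k) := by
    have := S.mink_map P hP w b
    rw [mink_comm w b, hbw, hPb, mink_add_right, mink_smul_right, mink_smul_right, h1] at this
    have h' : ε * (ε * mink (P w) b + k * mink v w) = 0 := by rw [this, mul_zero]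
    linear_combination h' - mink (P w) b * hε
  have h3 := S.mink_map P hP w w
  rw [hw.self] at h3
  rw [h1, h2, div_self hne, one_smul] at e
  set a := mink (P w) w / mink v w with ha
  rw [e] at h3
  simp only [mink_add_left, mink_add_right, mink_smul_left, mink_smul_right, hv.self, hw.self,
    hbv, hbw, hbb, mink_comm v b, mink_comm w b, mink_comm w v] at h3
  have ha' : a = -(mink v w * k ^ 2 / 2) := by
    have : mink v w * (a + mink v w * k ^ 2 / 2) = 0 := by
      linear_combination h3 / 2 - mink v w ^ 2 * k ^ 2 / 2 * hε
    linarith [(mul_eq_zero.1 this).resolve_left hne]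
  rw [e, ha']; module

/-- A nontrivial deck transformation that fixes an ideal point is a shear. -/
theorem exists_shear {P : V ≃ₗ[ℝ] V} (hP : P ∈ S.Γ) (hP1 : P ≠ 1) {v w b : V} (hv : Null v)
    (hw : Null w) (hvw : mink v w < 0) (hb : b 3 = 0) (hbb : mink b b = 1) (hbv : mink b v = 0)
    (hbw : mink b w = 0) (hPv : P v = v) : ∃ k : ℝ, k ≠ 0 ∧ P b = b + k • v := by
  have hne := hvw.ne
  have e := expand_null hv hw hvw hb hbb hbv hbw (x := P b) (by rw [apply_flat hP, hb])
  have h1 : mink (P b) v = 0 := by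
    conv_lhs => rw [← hPv]
    rw [S.mink_map P hP, hbv]
  rw [h1, zero_div, zero_smul, add_zero] at e
  set k := mink (P b) w / mink v w
  set ε := mink (P b) b
  have hε : ε ^ 2 = 1 := by
    have h2 := S.mink_map P hP b b
    rw [e] at h2
    simp only [mink_add_left, mink_add_right, mink_smul_left, mink_smul_right, hv.self,
      hbv, hbb, mink_comm v b] at h2
    linarith
  rw [add_comm] at e
  have hPw := shear_apply hP hv hw hvw hb hbb hbv hbw hPv hε e
  rcases sq_eq_sq_iff_eq_or_eq_neg.1 (hε.trans (one_pow 2).symm) with h | h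
  · rw [h, one_smul] at e
    refine ⟨k, fun hk => hP1 ?_, e⟩
    refine eq_one_of_fixes hP (x := v + w) (by simp [hv.flat, hw.flat]) ?_ ?_
    · simp only [mink_add_left, mink_add_right, hv.self, hw.self, mink_comm w v]; linarith
    · rw [map_add, hPv, hPw, hk]; simp
  · exfalso
    -- For `ε = -1` the vector `w + (k * mink v w / 2) • b` is fixed. The added multiple of the
    -- fixed vector `v` makes it timelike.
    refine hP1 (eq_one_of_fixes hP (x := (1 - k ^ 2 * mink v w) • v + w + (k * mink v w / 2) • b)
      ?_ ?_ ?_)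
    · simp [hv.flat, hw.flat, hb]
    · simp only [mink_add_left, mink_add_right, mink_smul_left, mink_smul_right, hv.self, hw.self,
        hbv, hbw, hbb, mink_comm v b, mink_comm w b, mink_comm w v]
      nlinarith [sq_nonneg (k * mink v w)]
    · rw [map_add, map_add, map_smul, map_smul, hPv, hPw, e, h]
      module

end CuspSurface

theorem Null.exists_transverse {v : V} (hv : Null v) : ∃ w, Null w ∧ mink v w < 0 := by
  obtain ⟨h3, h0, h⟩ := hv
  refine ⟨![v 0, -v 1, -v 2, 0], ⟨rfl, h0, ?_⟩, ?_⟩ <;> simp [mink, h3] at h ⊢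
  · linarith
  · nlinarith [sq_nonneg (v 1), sq_nonneg (v 2)]

namespace CuspSurface

variable {n : ℕ} {S : CuspSurface n}

/-- The translation length `κ` of some deck transformation that fixes a cusp. -/
theorem exists_shear_constant (S : CuspSurface n) (i : Fin n) : ∃ κ : ℝ, 0 < κ ∧ ∀ v, S.IsLift i v →
    ∃ P ∈ S.Γ, P v = v ∧ ∀ b : V, b 3 = 0 → mink b b = 1 → mink b v = 0 →
      ∃ k : ℝ, |k| = κ ∧ P b = b + k • v := by
  obtain ⟨P, hP, hP1, hPv⟩ := S.parabolic i
  have hv := horo_null (S := S) i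
  obtain ⟨w, hw, hvw⟩ := hv.exists_transverse
  obtain ⟨b, hb, hbb, hbv, hbw⟩ := exists_unit_normal hv hw hvw
  obtain ⟨k, hk, hPb⟩ := exists_shear hP hP1 hv hw hvw hb hbb hbv hbw hPv
  refine ⟨|k|, abs_pos.2 hk, ?_⟩
  rintro _ ⟨γ, hγ, rfl⟩
  refine ⟨γ * P * γ⁻¹, mul_mem (mul_mem hγ hP) (inv_mem hγ), ?_, ?_⟩
  · change γ (P (γ⁻¹ (γ _))) = _
    rw [inv_apply_apply, hPv]
  intro b' hb' hbb' hbv'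
  obtain ⟨c, rfl⟩ : ∃ c, b' = γ c := ⟨γ⁻¹ b', (apply_inv_apply γ b').symm⟩
  rw [apply_flat hγ] at hb'
  rw [S.mink_map γ hγ] at hbb' hbv'
  have e := expand_null hv hw hvw hb hbb hbv hbw hb'
  rw [hbv', zero_div, zero_smul, add_zero] at e
  -- A unit vector of `ℝ^{1,2}` orthogonal to the light vector is `± b` plus a multiple of this
  -- vector, so the shear parameter changes at most its sign.
  have hβ : |mink c b| = 1 := by
    rw [← sq_eq_sq₀ (abs_nonneg _) zero_le_one, sq_abs, one_pow]
    rw [e] at hbb'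
    simp only [mink_add_left, mink_add_right, mink_smul_left, mink_smul_right, hv.self,
      hbv, hbb, mink_comm (S.horo i) b] at hbb'
    linarith
  refine ⟨mink c b * k, by rw [abs_mul, hβ, one_mul], ?_⟩
  change γ (P (γ⁻¹ (γ _))) = _
  rw [inv_apply_apply, ← map_smul, ← map_add]
  congr 1
  conv_lhs => rw [e]
  rw [map_add, map_smul, map_smul, hPv, hPb]
  conv_rhs => rw [e]
  simp only [mink_add_left, mink_smul_left, hbb, mink_comm (S.horo i) b, hbv]
  module

/-- Two shears with centres `v`, `w` and with a small product of translation lengths generate an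
elliptic transformation. -/
theorem shear_product_le {P Q : V ≃ₗ[ℝ] V} (hP : P ∈ S.Γ) (hQ : Q ∈ S.Γ) {v w b : V}
    (hv : Null v) (hw : Null w) (hvw : mink v w < 0) (hb : b 3 = 0) (hbb : mink b b = 1)
    (hbv : mink b v = 0) (hbw : mink b w = 0) (hPv : P v = v) (hQw : Q w = w) {k l : ℝ}
    (hPb : P b = b + k • v) (hQb : Q b = b + l • w) (hkl : k * l < 0) :
    8 ≤ k * l * mink v w := by
  by_contra hlt
  push Not at hlt
  have hPw := shear_apply hP hv hw hvw hb hbb hbv hbw hPv (ε := 1) (by norm_num)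
    (by rw [hPb, one_smul])
  have hQv := shear_apply hQ hw hv (by rwa [mink_comm]) hb hbb hbw hbv hQw (ε := 1) (by norm_num)
    (by rw [hQb, one_smul])
  rw [mink_comm w v] at hQv
  -- The vector fixed by `P * Q` has the square `X * (X - 8) / 16` with `X = k * l * mink v w`, so
  -- it is timelike for `0 < X < 8`.
  have hfix : (P * Q) ((k / 2) • v + (-(l / 2)) • w + (k * l * mink v w / 4) • b) =
      (k / 2) • v + (-(l / 2)) • w + (k * l * mink v w / 4) • b := by
    change P (Q _) = _
    simp only [map_add, map_smul, hPv, hQw, hPb, hQb, hPw, hQv]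
    module
  have h1 := eq_one_of_fixes (mul_mem hP hQ)
    (x := (k / 2) • v + (-(l / 2)) • w + (k * l * mink v w / 4) • b)
    (by simp [hv.flat, hw.flat, hb]) (by
      simp only [mink_add_left, mink_add_right, mink_smul_left, mink_smul_right, hv.self, hw.self,
        hbv, hbw, hbb, mink_comm v b, mink_comm w b, mink_comm w v]
      have h2 : 0 < k * l * mink v w := mul_pos_of_neg_of_neg hkl hvw
      nlinarith [mul_pos h2 (sub_pos.2 hlt)]) hfix
  have h2 : P (Q b) = b := by
    change (P * Q) b = b
    rw [h1]; rfl
  rw [hQb, map_add, map_smul, hPb, hPw] at h2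
  -- The `b`-component of `P (Q b)` is `1 - k * l * mink v w`.
  have h3 := congrArg (mink b) h2
  simp only [mink_add_right, mink_smul_right, hbv, hbw, hbb] at h3
  have h4 : 0 < k * l * mink v w := mul_pos_of_neg_of_neg hkl hvw
  linarith

/-- The lifts of the canonical horocycles are uniformly separated. -/
theorem exists_separation (S : CuspSurface n) : ∃ δ : ℝ, 0 < δ ∧ ∀ i j v w, S.IsLift i v →
    S.IsLift j w → v ≠ w → mink v w ≤ -δ := by
  choose κ hκ h using S.exists_shear_constant
  have hsum : ∀ i, κ i ≤ ∑ j, κ j := fun i =>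
    Finset.single_le_sum (fun j _ => (hκ j).le) (Finset.mem_univ i)
  have hpos : 0 ≤ ∑ j, κ j := Finset.sum_nonneg fun j _ => (hκ j).le
  -- The bound `8 / (κ i * κ j)` is made uniform in the cusps. The summand `1` keeps the denominator
  -- positive for an empty sum.
  refine ⟨8 / (∑ j, κ j + 1) ^ 2, by positivity, fun i j v w hv hw hne => ?_⟩
  have hvw := hv.mink_neg hw hne
  obtain ⟨b, hb, hbb, hbv, hbw⟩ := exists_unit_normal hv.null hw.null hvw
  obtain ⟨P, hP, hPv, hPb⟩ := h i v hv
  obtain ⟨Q, hQ, hQw, hQb⟩ := h j w hw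
  obtain ⟨k, hk, hPb⟩ := hPb b hb hbb hbv
  obtain ⟨l, hl, hQb⟩ := hQb b hb hbb hbw
  have hkl : |k * l| = κ i * κ j := by rw [abs_mul, hk, hl]
  have hkl0 : 0 < κ i * κ j := mul_pos (hκ i) (hκ j)
  have main : 8 ≤ -(κ i * κ j) * mink v w := by
    rcases lt_trichotomy (k * l) 0 with h0 | h0 | h0
    · rw [← hkl, abs_of_neg h0, neg_neg]
      exact shear_product_le hP hQ hv.null hw.null hvw hb hbb hbv hbw hPv hQw hPb hQb h0
    · rw [h0, abs_zero] at hkl; linarith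
    -- The inverse shear has the parameter `-k`, which gives the product the required sign.
    · have hP' : P⁻¹ v = v := by conv_lhs => rw [← hPv, inv_apply_apply]
      have hPb' : P⁻¹ b = b + (-k) • v := by
        have : b = P⁻¹ (b + k • v) := by rw [← hPb, inv_apply_apply]
        rw [map_add, map_smul, hP'] at this
        nth_rewrite 2 [this]
        module
      have := shear_product_le (inv_mem hP) hQ hv.null hw.null hvw hb hbb hbv hbw hP' hQw hPb' hQb
        (by linarith)
      rwa [neg_mul, ← abs_of_pos h0, hkl] at this
  have hle : κ i * κ j ≤ (∑ j, κ j + 1) ^ 2 := by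
    nlinarith [hsum i, hsum j, hκ i, hκ j, mul_le_mul (hsum i) (hsum j) (hκ j).le hpos]
  have h8 : 8 ≤ -mink v w * (∑ j, κ j + 1) ^ 2 := by nlinarith
  have := (div_le_iff₀ (by positivity : (0 : ℝ) < (∑ j, κ j + 1) ^ 2)).2 h8
  linarith

end CuspSurface

/-! ### Cones -/

/-- The convex cone spanned by a set of vectors. -/
abbrev cone (A : Set V) : PointedCone ℝ V := PointedCone.hull ℝ A

theorem subset_cone {A : Set V} {v : V} (h : v ∈ A) : v ∈ cone A := Submodule.subset_span h

theorem cone_mono {A B : Set V} (h : A ⊆ B) {x : V} (hx : x ∈ cone A) : x ∈ cone B :=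
  Submodule.span_mono h hx

theorem cone_smul {A : Set V} {x : V} (hx : x ∈ cone A) {c : ℝ} (hc : 0 ≤ c) : c • x ∈ cone A :=
  PointedCone.smul_mem (cone A) hc hx

theorem cone_add {A : Set V} {x y : V} (hx : x ∈ cone A) (hy : y ∈ cone A) : x + y ∈ cone A :=
  (cone A).add_mem hx hy

theorem cone_induction {A : Set V} {p : V → Prop} (mem : ∀ v ∈ A, p v) (zero : p 0)
    (add : ∀ x y, p x → p y → p (x + y)) (smul : ∀ (c : ℝ), 0 ≤ c → ∀ x, p x → p (c • x)) {x : V}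
    (hx : x ∈ cone A) : p x :=
  Submodule.span_induction (p := fun x _ => p x) (fun v hv => mem v hv) zero
    (fun x y _ _ => add x y) (fun (c : ℝ≥0) x _ hx => smul c c.2 x hx) hx

theorem mink_le_of_mem_cone {A : Set V} {m m' : V} (h : ∀ v ∈ A, mink m v ≤ mink m' v) {x : V}
    (hx : x ∈ cone A) : mink m x ≤ mink m' x := by
  refine cone_induction (p := fun x => mink m x ≤ mink m' x) h ?_ ?_ ?_ hx
  · simp [mink_zero_right]
  · intro x y hx hy; rw [mink_add_right, mink_add_right]; exact add_le_add hx hy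
  · intro c hc x hx; rw [mink_smul_right, mink_smul_right]; exact mul_le_mul_of_nonneg_left hx hc

theorem mink_eq_of_mem_cone {A : Set V} {m m' : V} (h : ∀ v ∈ A, mink m v = mink m' v) {x : V}
    (hx : x ∈ cone A) : mink m x = mink m' x :=
  le_antisymm (mink_le_of_mem_cone (fun v hv => (h v hv).le) hx)
    (mink_le_of_mem_cone (fun v hv => (h v hv).ge) hx)

theorem causal_of_mem_cone {A : Set V} (h : ∀ v ∈ A, Causal v) {x : V} (hx : x ∈ cone A) :
    Causal x :=
  cone_induction h Causal.zero (fun _ _ => Causal.add) (fun _ hc _ hx => hx.smul hc) hx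

theorem mem_cone_image {A : Set V} (γ : V ≃ₗ[ℝ] V) {x : V} (hx : x ∈ cone A) :
    γ x ∈ cone (γ '' A) := by
  refine cone_induction (p := fun x => γ x ∈ cone (γ '' A)) ?_ ?_ ?_ ?_ hx
  · exact fun v hv => subset_cone ⟨v, hv, rfl⟩
  · rw [map_zero]; exact zero_mem _
  · intro x y hx hy; rw [map_add]; exact cone_add hx hy
  · intro c hc x hx; rw [map_smul]; exact cone_smul hx hc

theorem mem_cone_singleton {a x : V} (hx : x ∈ cone {a}) : ∃ α : ℝ, 0 ≤ α ∧ x = α • a := by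
  obtain ⟨α, rfl⟩ := Submodule.mem_span_singleton.1 hx
  exact ⟨α, α.2, rfl⟩

theorem mem_cone_pair {a b x : V} (hx : x ∈ cone {a, b}) :
    ∃ α β : ℝ, 0 ≤ α ∧ 0 ≤ β ∧ x = α • a + β • b := by
  obtain ⟨α, β, rfl⟩ := Submodule.mem_span_pair.1 hx
  exact ⟨α, β, α.2, β.2, rfl⟩

theorem mem_cone_triple {a b c x : V} (hx : x ∈ cone {a, b, c}) :
    ∃ α β γ : ℝ, 0 ≤ α ∧ 0 ≤ β ∧ 0 ≤ γ ∧ x = α • a + β • b + γ • c := by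
  obtain ⟨α, β, γ, rfl⟩ := Submodule.mem_span_triple.1 hx
  exact ⟨α, β, γ, α.2, β.2, γ.2, rfl⟩

theorem combination_mem_cone {a b c : V} {α β γ : ℝ} (hα : 0 ≤ α) (hβ : 0 ≤ β) (hγ : 0 ≤ γ) :
    α • a + β • b + γ • c ∈ cone {a, b, c} :=
  cone_add (cone_add (cone_smul (subset_cone (by simp)) hα) (cone_smul (subset_cone (by simp)) hβ))
    (cone_smul (subset_cone (by simp)) hγ)

/-- Three lightlike vectors with pairwise different directions. -/
structure IdealTriangle (a b c : V) : Prop where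
  na : Null a
  nb : Null b
  nc : Null c
  ab : mink a b < 0
  ac : mink a c < 0
  bc : mink b c < 0

namespace IdealTriangle

variable {a b c : V}

theorem det_ne_zero (h : IdealTriangle a b c) : det3 a b c ≠ 0 :=
  det3_ne_zero h.na h.nb h.nc h.ab h.ac h.bc

theorem rotate (h : IdealTriangle a b c) : IdealTriangle b c a :=
  ⟨h.nb, h.nc, h.na, h.bc, by rw [mink_comm]; exact h.ab, by rw [mink_comm]; exact h.ac⟩

/-- The coordinates with respect to three independent vectors. -/
theorem eq_combination (h : IdealTriangle a b c) {x : V} (hx : x 3 = 0) :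
    x = (det3 x b c / det3 a b c) • a + (det3 a x c / det3 a b c) • b +
      (det3 a b x / det3 a b c) • c := by
  have hD := h.det_ne_zero
  have := cramer a b c x h.na.flat h.nb.flat h.nc.flat hx
  calc x = (det3 a b c)⁻¹ • (det3 a b c • x) := (inv_smul_smul₀ hD x).symm
    _ = _ := by rw [this]; simp only [smul_add, smul_smul, div_eq_inv_mul]

theorem coords_combination (h : IdealTriangle a b c) (α β γ : ℝ) :
    det3 (α • a + β • b + γ • c) b c / det3 a b c = α ∧
    det3 a (α • a + β • b + γ • c) c / det3 a b c = β ∧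
    det3 a b (α • a + β • b + γ • c) / det3 a b c = γ := by
  have hD := h.det_ne_zero
  refine ⟨?_, ?_, ?_⟩ <;> rw [div_eq_iff hD] <;>
    simp only [det3, Pi.add_apply, Pi.smul_apply, smul_eq_mul] <;> ring

theorem mem_cone_iff (h : IdealTriangle a b c) {x : V} : x ∈ cone {a, b, c} ↔ x 3 = 0 ∧
    0 ≤ det3 x b c / det3 a b c ∧ 0 ≤ det3 a x c / det3 a b c ∧ 0 ≤ det3 a b x / det3 a b c := by
  constructor
  · intro hx
    obtain ⟨α, β, γ, hα, hβ, hγ, rfl⟩ := mem_cone_triple hx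
    obtain ⟨h1, h2, h3⟩ := h.coords_combination α β γ
    rw [h1, h2, h3]
    exact ⟨by simp [h.na.flat, h.nb.flat, h.nc.flat], hα, hβ, hγ⟩
  · rintro ⟨h3, h0, h1, h2⟩
    rw [h.eq_combination h3]
    exact combination_mem_cone h0 h1 h2

theorem isClosed_cone (h : IdealTriangle a b c) : IsClosed (cone {a, b, c} : Set V) := by
  have : (cone {a, b, c} : Set V) = {x | x 3 = 0 ∧
    0 ≤ det3 x b c / det3 a b c ∧ 0 ≤ det3 a x c / det3 a b c ∧
    0 ≤ det3 a b x / det3 a b c} := Set.ext fun x => h.mem_cone_iff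
  rw [this]
  simp only [Set.ofPred_and]
  refine (isClosed_eq (by fun_prop) continuous_const).inter
    ((isClosed_le continuous_const ?_).inter
    ((isClosed_le continuous_const ?_).inter (isClosed_le continuous_const ?_))) <;>
  · simp only [det3]; fun_prop

end IdealTriangle

/-! ### Local finiteness of lifts and triangulations -/

namespace CuspSurface

variable {n : ℕ} {S : CuspSurface n}

/-- The set of all lifts of the canonical horocycles. -/
def lifts (S : CuspSurface n) : Set V := {v | ∃ i, S.IsLift i v}

theorem null_of_lifts {v : V} (h : v ∈ S.lifts) : Null v := h.choose_spec.null

theorem mink_neg_of_lifts {v w : V} (hv : v ∈ S.lifts) (hw : w ∈ S.lifts) (hne : v ≠ w) :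
    mink v w < 0 := hv.choose_spec.mink_neg hw.choose_spec hne

theorem eq_of_smul_of_lifts {v w : V} (hv : v ∈ S.lifts) (hw : w ∈ S.lifts) {c : ℝ}
    (h : w = c • v) : v = w := hv.choose_spec.eq_of_smul hw.choose_spec h

theorem finite_of_separated {L : Set V} {ε R : ℝ} (hε : 0 < ε) (hR : ∀ v ∈ L, ‖v‖ ≤ R)
    (h : ∀ v ∈ L, ∀ w ∈ L, v ≠ w → ε ≤ dist v w) : L.Finite := by
  have htb : TotallyBounded L := (isCompact_closedBall (0 : V) R).totallyBounded.subset
    fun v hv => by simpa using hR v hv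
  obtain ⟨t, ht, hL⟩ := Metric.totallyBounded_iff.1 htb (ε / 2) (by positivity)
  have h1 : ∀ v ∈ L, ∃ y ∈ t, dist v y < ε / 2 := fun v hv => by simpa using hL hv
  choose! f hf hd using h1
  refine Set.Finite.of_finite_image (f := f) (ht.subset (Set.image_subset_iff.2 hf)) ?_
  intro v hv w hw hvw
  by_contra hne
  have h2 := h v hv w hw hne
  have h3 := dist_triangle_right v w (f v)
  have h4 := hd w hw
  rw [← hvw] at h4
  linarith [hd v hv]

/-- The difference of two lifts has Minkowski square at least `2 * δ`, and only two coordinates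
contribute positively to it. One of them is at least `√δ` in absolute value, so lifts are separated
in the sup norm. -/
theorem finite_lifts (S : CuspSurface n) (R : ℝ) : {v ∈ S.lifts | v 0 ≤ R}.Finite := by
  obtain ⟨δ, hδ, h⟩ := S.exists_separation
  refine finite_of_separated (ε := Real.sqrt δ) (R := R) (Real.sqrt_pos.2 hδ) ?_ ?_
  · rintro v ⟨hv, hR⟩
    have hn := null_of_lifts hv
    have h0 := hn.pos
    have hs := hn.self
    simp only [mink, hn.flat] at hs
    refine (pi_norm_le_iff_of_nonneg (h0.le.trans hR)).2 fun i => (Real.norm_eq_abs _).le.trans ?_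
    refine (abs_le_of_sq_le_sq (b := v 0) ?_ h0.le).trans hR
    fin_cases i
    · exact le_rfl
    · change v 1 ^ 2 ≤ _; nlinarith [sq_nonneg (v 2)]
    · change v 2 ^ 2 ≤ _; nlinarith [sq_nonneg (v 1)]
    · change v 3 ^ 2 ≤ _; rw [hn.flat]; nlinarith
  · rintro v ⟨hv, -⟩ w ⟨hw, -⟩ hne
    obtain ⟨i, hi⟩ := hv
    obtain ⟨j, hj⟩ := hw
    have h1 := h i j v w hi hj hne
    have h2 : mink (v - w) (v - w) = -2 * mink v w := by
      rw [mink_sub_left, mink_sub_right, mink_sub_right, hi.null.self, hj.null.self, mink_comm w v]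
      ring
    have h3 : ∀ i, (v i - w i) ^ 2 ≤ dist v w ^ 2 := fun i => by
      rw [← sq_abs, ← Real.dist_eq]
      exact pow_le_pow_left₀ dist_nonneg (dist_le_pi_dist v w i) 2
    apply Real.sqrt_le_iff.2 ⟨dist_nonneg, _⟩
    simp only [mink, Pi.sub_apply, hi.null.flat, hj.null.flat] at h1 h2
    have h4 := h3 1
    have h5 := h3 2
    nlinarith [sq_nonneg (v 0 - w 0)]

namespace Triangulation

variable (T : S.Triangulation)

theorem lift_mem {T : S.Triangulation} {Δ : Set V} (hΔ : Δ ∈ T.faces) {v : V} (hv : v ∈ Δ) :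
    v ∈ S.lifts := T.lift Δ hΔ v hv

variable {T}

theorem exists_vertices {Δ : Set V} (hΔ : Δ ∈ T.faces) :
    ∃ a b c, IdealTriangle a b c ∧ Δ = {a, b, c} := by
  obtain ⟨a, b, c, hab, hac, hbc, rfl⟩ := Set.ncard_eq_three.1 (T.card Δ hΔ)
  have ha : a ∈ S.lifts := lift_mem hΔ (by simp)
  have hb : b ∈ S.lifts := lift_mem hΔ (by simp)
  have hc : c ∈ S.lifts := lift_mem hΔ (by simp)
  exact ⟨a, b, c, ⟨null_of_lifts ha, null_of_lifts hb, null_of_lifts hc,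
    mink_neg_of_lifts ha hb hab, mink_neg_of_lifts ha hc hac, mink_neg_of_lifts hb hc hbc⟩, rfl⟩

theorem causal_of_face {Δ : Set V} (hΔ : Δ ∈ T.faces) {x : V} (hx : x ∈ cone Δ) : Causal x :=
  causal_of_mem_cone (fun _ hv => (null_of_lifts (lift_mem hΔ hv)).causal) hx

theorem isClosed_cone {Δ : Set V} (hΔ : Δ ∈ T.faces) : IsClosed (cone Δ : Set V) := by
  obtain ⟨a, b, c, h, rfl⟩ := exists_vertices hΔ
  exact h.isClosed_cone

variable (T)

theorem exists_face {x : V} (hx : Timelike x) : ∃ Δ ∈ T.faces, x ∈ cone Δ := by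
  obtain ⟨c, hc, h⟩ := hx.exists_smul_mem_H2
  obtain ⟨Δ, hΔ, hxΔ⟩ := T.cover _ h
  refine ⟨Δ, hΔ, ?_⟩
  have := cone_smul (A := Δ) hxΔ.2 (inv_nonneg.2 hc.le)
  rwa [inv_smul_smul₀ hc.ne'] at this

variable {T}

theorem mem_cone_inter {x : V} (hx : Timelike x) {Δ Δ' : Set V} (hΔ : Δ ∈ T.faces)
    (hΔ' : Δ' ∈ T.faces) (h : x ∈ cone Δ) (h' : x ∈ cone Δ') : x ∈ cone (Δ ∩ Δ') := by
  obtain ⟨c, hc, hH⟩ := hx.exists_smul_mem_H2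
  have h1 := T.inter Δ hΔ Δ' hΔ' ⟨⟨hH.1, cone_smul h hc.le⟩, ⟨hH.1, cone_smul h' hc.le⟩⟩
  have := cone_smul (A := Δ ∩ Δ') h1.2 (inv_nonneg.2 hc.le)
  rwa [inv_smul_smul₀ hc.ne'] at this

/-- Different triangles with a common point have a common edge. -/
theorem exists_common_edge {x : V} (hx : Timelike x) {Δ Δ' : Set V} (hΔ : Δ ∈ T.faces)
    (hΔ' : Δ' ∈ T.faces) (hne : Δ ≠ Δ') (h : x ∈ cone Δ) (h' : x ∈ cone Δ') :
    ∃ a b c d, Δ ∩ Δ' = {a, b} ∧ Δ = {a, b, c} ∧ Δ' = {a, b, d} ∧ IdealTriangle a b c ∧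
      IdealTriangle a b d := by
  have hcard := T.card Δ hΔ
  have hcard' := T.card Δ' hΔ'
  have hfin : Δ.Finite := Set.finite_of_ncard_pos (by omega)
  have hfin' : Δ'.Finite := Set.finite_of_ncard_pos (by omega)
  have hle : (Δ ∩ Δ').ncard ≤ 3 := hcard ▸ Set.ncard_le_ncard Set.inter_subset_left hfin
  have hx' := mem_cone_inter hx hΔ hΔ' h h'
  have h3 : (Δ ∩ Δ').ncard ≠ 3 := fun h3 => by
    have e1 := Set.eq_of_subset_of_ncard_le (Set.inter_subset_left (s := Δ) (t := Δ'))
      (by omega) hfin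
    have e2 := Set.eq_of_subset_of_ncard_le (Set.inter_subset_right (s := Δ) (t := Δ'))
      (by omega) hfin'
    exact hne (e1.symm.trans e2)
  -- The cones over the empty set and over a single light vector contain no timelike vector.
  have h0 : (Δ ∩ Δ').ncard ≠ 0 := fun h0 => by
    rw [Set.ncard_eq_zero (hfin.subset Set.inter_subset_left)] at h0
    rw [h0] at hx'
    exact hx.ne_zero (by simpa [cone] using hx')
  have h1 : (Δ ∩ Δ').ncard ≠ 1 := fun h1 => by
    obtain ⟨a, ha⟩ := Set.ncard_eq_one.1 h1
    have haΔ : a ∈ Δ := Set.inter_subset_left (ha ▸ Set.mem_singleton a)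
    rw [ha] at hx'
    obtain ⟨α, -, rfl⟩ := mem_cone_singleton hx'
    have := hx.neg
    rw [mink_smul_left, mink_smul_right, (null_of_lifts (lift_mem hΔ haΔ)).self] at this
    simp at this
  obtain ⟨a, b, hab, he⟩ := Set.ncard_eq_two.1 (show (Δ ∩ Δ').ncard = 2 by omega)
  have key : ∀ Δ : Set V, Δ ∈ T.faces → {a, b} ⊆ Δ → ∃ c, Δ = {a, b, c} ∧ IdealTriangle a b c := by
    intro Δ hΔ hsub
    have hcard := T.card Δ hΔ
    have hfin : Δ.Finite := Set.finite_of_ncard_pos (by omega)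
    obtain ⟨c, hc, hcn⟩ := Set.exists_mem_notMem_of_ncard_lt_ncard
      (show ({a, b} : Set V).ncard < Δ.ncard by rw [hcard, Set.ncard_pair hab]; norm_num)
    simp only [Set.mem_insert_iff, Set.mem_singleton_iff, not_or] at hcn
    have hca := hcn.1
    have hcb := hcn.2
    have e : ({a, b, c} : Set V) = Δ := by
      refine Set.eq_of_subset_of_ncard_le ?_ ?_ hfin
      · intro y hy
        rcases hy with rfl | rfl | rfl
        · exact hsub (by simp)
        · exact hsub (by simp)
        · exact hc
      · rw [hcard, Set.ncard_eq_three.2 ⟨a, b, c, hab, Ne.symm hca, Ne.symm hcb, rfl⟩]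
    have la := lift_mem hΔ (hsub (show a ∈ {a, b} by simp))
    have lb := lift_mem hΔ (hsub (show b ∈ {a, b} by simp))
    have lc := lift_mem hΔ hc
    exact ⟨c, e.symm, null_of_lifts la, null_of_lifts lb, null_of_lifts lc,
      mink_neg_of_lifts la lb hab, mink_neg_of_lifts la lc (Ne.symm hca),
      mink_neg_of_lifts lb lc (Ne.symm hcb)⟩
  obtain ⟨c, hc, htc⟩ := key Δ hΔ (he ▸ Set.inter_subset_left)
  obtain ⟨d, hd, htd⟩ := key Δ' hΔ' (he ▸ Set.inter_subset_right)
  exact ⟨a, b, c, d, he, hc, hd, htc, htd⟩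

variable (T)

/-- There are finitely many orbits of triangles, and deck transformations preserve the products. -/
theorem exists_mink_bound : ∃ M : ℝ, 0 < M ∧ ∀ Δ ∈ T.faces, ∀ v ∈ Δ, ∀ w ∈ Δ, -mink v w ≤ M := by
  obtain ⟨F, hF, hsub, h⟩ := T.finite
  have h1 : ∀ Δ ∈ F, ∃ M : ℝ, ∀ v ∈ Δ, ∀ w ∈ Δ, -mink v w ≤ M := by
    intro Δ hΔ
    have hfin : Δ.Finite := Set.finite_of_ncard_pos (by rw [T.card Δ (hsub hΔ)]; norm_num)
    obtain ⟨M, hM⟩ := (hfin.image2 (fun v w => -mink v w) hfin).bddAbove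
    exact ⟨M, fun v hv w hw => hM ⟨v, hv, w, hw, rfl⟩⟩
  choose! M hM using h1
  obtain ⟨B, hB⟩ := (hF.image M).bddAbove
  refine ⟨max B 1, by positivity, fun Δ hΔ v hv w hw => ?_⟩
  obtain ⟨γ, hγ, Δ₀, hΔ₀, rfl⟩ := h Δ hΔ
  obtain ⟨v, hv, rfl⟩ := hv
  obtain ⟨w, hw, rfl⟩ := hw
  rw [S.mink_map γ hγ]
  exact (hM Δ₀ hΔ₀ v hv w hw).trans ((hB ⟨Δ₀, hΔ₀, rfl⟩).trans (le_max_left _ _))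

/-- A point sufficiently near to a cusp lies in a triangle with a vertex at this cusp. -/
theorem exists_depth : ∃ κ : ℝ, 0 < κ ∧ ∀ Δ ∈ T.faces, ∀ u ∈ cone Δ, ∀ w ∈ S.lifts, w ∉ Δ →
    κ * -mink u u ≤ mink w u ^ 2 := by
  obtain ⟨δ, hδ, hsep⟩ := S.exists_separation
  obtain ⟨M, hM, hbd⟩ := T.exists_mink_bound
  -- If `σ` is the sum of the coefficients of `u`, then `-mink u u ≤ M * σ ^ 2` and `-mink w u ≥ δ *
  -- σ`.
  refine ⟨δ ^ 2 / M, by positivity, fun Δ hΔ u hu w hw hwΔ => ?_⟩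
  have hsep' : ∀ v ∈ Δ, mink w v ≤ -δ := fun v hv => by
    obtain ⟨i, hi⟩ := hw
    obtain ⟨j, hj⟩ := lift_mem hΔ hv
    exact hsep i j w v hi hj fun h => hwΔ (h ▸ hv)
  have hb := hbd Δ hΔ
  obtain ⟨a, b, c, ht, rfl⟩ := exists_vertices hΔ
  obtain ⟨α, β, γ, hα, hβ, hγ, rfl⟩ := mem_cone_triple hu
  have ha := hsep' a (by simp)
  have hb' := hsep' b (by simp)
  have hc := hsep' c (by simp)
  have hab := hb a (by simp) b (by simp)
  have hac := hb a (by simp) c (by simp)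
  have hbc := hb b (by simp) c (by simp)
  have h1 : -mink (α • a + β • b + γ • c) (α • a + β • b + γ • c) ≤ M * (α + β + γ) ^ 2 := by
    simp only [mink_add_left, mink_add_right, mink_smul_left, mink_smul_right, ht.na.self,
      ht.nb.self, ht.nc.self, mink_comm b a, mink_comm c a, mink_comm c b]
    nlinarith [mul_le_mul_of_nonneg_left hab (mul_nonneg hα hβ),
      mul_le_mul_of_nonneg_left hac (mul_nonneg hα hγ),
      mul_le_mul_of_nonneg_left hbc (mul_nonneg hβ hγ), mul_nonneg hM.le (sq_nonneg α),
      mul_nonneg hM.le (sq_nonneg β), mul_nonneg hM.le (sq_nonneg γ)]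
  have h2 : δ * (α + β + γ) ≤ -mink w (α • a + β • b + γ • c) := by
    simp only [mink_add_right, mink_smul_right]
    nlinarith [mul_le_mul_of_nonneg_left ha hα, mul_le_mul_of_nonneg_left hb' hβ,
      mul_le_mul_of_nonneg_left hc hγ]
  calc δ ^ 2 / M * -mink _ _ ≤ δ ^ 2 / M * (M * (α + β + γ) ^ 2) := by gcongr
    _ = (δ * (α + β + γ)) ^ 2 := by field_simp
    _ ≤ (-mink w (α • a + β • b + γ • c)) ^ 2 := by gcongr
    _ = _ := by ring

end Triangulation

end CuspSurface

/-- Induction along a real interval. -/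
theorem real_induction {P : ℝ → Prop} {a b : ℝ} (h0 : P a)
    (hr : ∀ t ∈ Set.Ico a b, P t → ∀ᶠ s in 𝓝[>] t, P s)
    (hl : ∀ t ∈ Set.Ioc a b, (∀ s ∈ Set.Ico a t, P s) → P t) : ∀ t ∈ Set.Icc a b, P t := by
  by_contra! hcon
  let B := {t | t ∈ Set.Icc a b ∧ ¬P t}
  have hB : B.Nonempty := hcon
  have hbd : BddBelow B := ⟨a, fun t ht => ht.1.1⟩
  set c := sInf B with hc
  have hac : a ≤ c := le_csInf hB fun t ht => ht.1.1
  have hcb : c ≤ b := by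
    obtain ⟨t, ht⟩ := hB
    exact (csInf_le hbd ht).trans ht.1.2
  have hlt : ∀ s ∈ Set.Ico a c, P s := fun s hs => by
    by_contra h
    exact absurd (csInf_le hbd (show s ∈ B from ⟨⟨hs.1, hs.2.le.trans hcb⟩, h⟩)) (not_le.2 hs.2)
  have hPc : P c := by
    rcases hac.eq_or_lt with h | h
    · rw [← h]; exact h0
    · exact hl c ⟨h, hcb⟩ hlt
  have hcb' : c < b := by
    refine lt_of_le_of_ne hcb fun h => ?_
    obtain ⟨t, ht, hPt⟩ := hcon
    rcases (csInf_le hbd (show t ∈ B from ⟨ht, hPt⟩)).eq_or_lt with h1 | h1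
    · exact hPt (h1 ▸ hPc)
    · exact absurd ht.2 (not_le.2 (h ▸ h1))
  obtain ⟨d, hd, hd'⟩ := (mem_nhdsGT_iff_exists_Ioo_subset).1 (hr c ⟨hac, hcb'⟩ hPc)
  obtain ⟨t, ht, htd⟩ := exists_lt_of_csInf_lt hB (show sInf B < d from hd)
  rcases (csInf_le hbd ht).eq_or_lt with h1 | h1
  · exact ht.2 (h1 ▸ hPc)
  · exact ht.2 (hd' ⟨h1, htd⟩)

/-- All terms in the expansion of `mink u u` are nonpositive, so the product of any two coefficients
vanishes. -/
theorem IdealTriangle.null_mem_cone {a b c u : V} (h : IdealTriangle a b c)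
    (hu : u ∈ cone {a, b, c}) (hn : Null u) : ∃ α : ℝ, 0 < α ∧ (u = α • a ∨ u = α • b ∨ u = α • c)
    := by
  obtain ⟨α, β, γ, hα, hβ, hγ, rfl⟩ := mem_cone_triple hu
  have hs := hn.self
  have hne := hn.ne_zero
  simp only [mink_add_left, mink_add_right, mink_smul_left, mink_smul_right, h.na.self,
    h.nb.self, h.nc.self, mink_comm b a, mink_comm c a, mink_comm c b] at hs
  have h1 : α * β * mink a b ≤ 0 := mul_nonpos_of_nonneg_of_nonpos (mul_nonneg hα hβ) h.ab.le
  have h2 : α * γ * mink a c ≤ 0 := mul_nonpos_of_nonneg_of_nonpos (mul_nonneg hα hγ) h.ac.le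
  have h3 : β * γ * mink b c ≤ 0 := mul_nonpos_of_nonneg_of_nonpos (mul_nonneg hβ hγ) h.bc.le
  have e1 : α * β = 0 := (mul_eq_zero.1 (show α * β * mink a b = 0 by linarith)).resolve_right h.ab.ne
  have e2 : α * γ = 0 := (mul_eq_zero.1 (show α * γ * mink a c = 0 by linarith)).resolve_right h.ac.ne
  have e3 : β * γ = 0 := (mul_eq_zero.1 (show β * γ * mink b c = 0 by linarith)).resolve_right h.bc.ne
  rcases hα.eq_or_lt with h0 | h0
  · rcases hβ.eq_or_lt with h0' | h0'
    · rcases hγ.eq_or_lt with h0'' | h0''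
      · exact absurd (by simp [← h0, ← h0', ← h0'']) hne
      · exact ⟨γ, h0'', .inr (.inr (by simp [← h0, ← h0']))⟩
    · have : γ = 0 := (mul_eq_zero.1 e3).resolve_left h0'.ne'
      exact ⟨β, h0', .inr (.inl (by simp [← h0, this]))⟩
  · have hb : β = 0 := (mul_eq_zero.1 e1).resolve_left h0.ne'
    have hc : γ = 0 := (mul_eq_zero.1 e2).resolve_left h0.ne'
    exact ⟨α, h0, .inl (by simp [hb, hc])⟩

namespace CuspSurface

variable {n : ℕ} {S : CuspSurface n}

namespace Triangulation

variable {T : S.Triangulation}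

theorem exists_vertex_of_null {Δ : Set V} (hΔ : Δ ∈ T.faces) {u : V} (hu : u ∈ cone Δ)
    (hn : Null u) : ∃ (α : ℝ) (a b c : V), 0 < α ∧ u = α • a ∧ IdealTriangle a b c ∧
      Δ = {a, b, c} := by
  obtain ⟨a, b, c, h, rfl⟩ := exists_vertices hΔ
  obtain ⟨α, hα, h1 | h1 | h1⟩ := h.null_mem_cone hu hn
  · exact ⟨α, a, b, c, hα, h1, h, rfl⟩
  · exact ⟨α, b, c, a, hα, h1, h.rotate, by ext; simp; tauto⟩
  · exact ⟨α, c, a, b, hα, h1, h.rotate.rotate, by ext; simp; tauto⟩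

/-- Separation gives `δ ≤ 2 * v 0 * w 0` for different lifts. Two fixed lifts `a` and `b` suffice
for comparison, since any `v` differs from one of them. -/
theorem exists_height_bound (T : S.Triangulation) : ∃ c : ℝ, 0 < c ∧ ∀ v ∈ S.lifts, c ≤ v 0 := by
  obtain ⟨Δ, hΔ, -⟩ := T.exists_face timelike_single
  obtain ⟨a, b, c, h, rfl⟩ := exists_vertices hΔ
  obtain ⟨δ, hδ, hsep⟩ := S.exists_separation
  have key : ∀ v ∈ S.lifts, ∀ w ∈ S.lifts, v ≠ w → δ ≤ 2 * v 0 * w 0 := by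
    rintro v ⟨i, hi⟩ w ⟨j, hj⟩ hne
    have h1 := hsep i j v w hi hj hne
    have hv := hi.null
    have hw := hj.null
    have h2 : mink v ![w 0, -w 1, -w 2, 0] ≤ 0 := by
      refine hv.causal.mink_nonpos ⟨rfl, hw.pos.le, ?_⟩
      have := hw.self
      simp only [mink, hw.flat] at this
      simp [mink]; linarith
    simp [mink] at h2
    simp only [mink, hv.flat] at h1
    linarith
  refine ⟨δ / (2 * (a 0 + b 0)), div_pos hδ (by linarith [h.na.pos, h.nb.pos]), fun v hv => ?_⟩
  rw [div_le_iff₀ (by linarith [h.na.pos, h.nb.pos])]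
  have hv0 := (null_of_lifts hv).pos
  by_cases hva : v = a
  · subst hva
    have := key v hv b (lift_mem hΔ (by simp)) fun hvb => by
      have := h.ab; rw [← hvb, h.na.self] at this; exact lt_irrefl _ this
    nlinarith [mul_pos hv0 h.na.pos]
  · have := key v hv a (lift_mem hΔ (by simp)) hva
    nlinarith [mul_pos hv0 h.nb.pos]

/-- Let `y` lie in the cone of a triangle with vertex `v`. The height bound limits the coefficients
of `y`, hence also `-mink v y`. Near a timelike `x`, on the other hand, `-mink v y ≥ η * v 0` with a
fixed `η > 0`. So `v 0` is bounded, and `finite_lifts` leaves finitely many triangles. -/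
theorem exists_finite_faces (T : S.Triangulation) {x : V} (hx : Timelike x) :
    ∃ F : Set (Set V), F.Finite ∧ F ⊆ T.faces ∧
      ∀ᶠ y in 𝓝 x, ∀ Δ ∈ T.faces, y ∈ cone Δ → Δ ∈ F := by
  obtain ⟨c, hc, hlow⟩ := T.exists_height_bound
  obtain ⟨M, hM, hbd⟩ := T.exists_mink_bound
  have hθ : Continuous fun y : V => y 0 - Real.sqrt (y 1 ^ 2 + y 2 ^ 2) := by fun_prop
  obtain ⟨η, hη, hηx⟩ : ∃ η : ℝ, 0 < η ∧ η < x 0 - Real.sqrt (x 1 ^ 2 + x 2 ^ 2) := by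
    have : 0 < x 0 - Real.sqrt (x 1 ^ 2 + x 2 ^ 2) := by
      rw [sub_pos, Real.sqrt_lt' hx.pos]
      have := hx.neg
      simp only [mink, hx.flat] at this
      linarith
    exact ⟨_, half_pos this, half_lt_self this⟩
  set R := x 0 + 1
  refine ⟨{Δ ∈ T.faces | Δ ⊆ {v ∈ S.lifts | v 0 ≤ M * (R / c) / η}},
    (S.finite_lifts _).finite_subsets.subset fun Δ hΔ => hΔ.2, fun Δ hΔ => hΔ.1, ?_⟩
  have h1 : ∀ᶠ y : V in 𝓝 x, y 0 < R :=
    (continuous_apply 0).continuousAt.eventually_lt continuousAt_const (lt_add_one _)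
  have h2 := continuousAt_const.eventually_lt hθ.continuousAt hηx
  filter_upwards [h1, h2] with y hy0 hyη Δ hΔ hyΔ
  refine ⟨hΔ, fun v hv => ⟨lift_mem hΔ hv, ?_⟩⟩
  have hvn := null_of_lifts (lift_mem hΔ hv)
  have hA : -mink v y ≤ M * (R / c) := by
    have hb := hbd Δ hΔ v hv
    have hlow' := fun v hv => hlow v (lift_mem hΔ hv)
    obtain ⟨p, q, r, ht, rfl⟩ := exists_vertices hΔ
    obtain ⟨α, β, γ, hα, hβ, hγ, rfl⟩ := mem_cone_triple hyΔ
    have hs : α + β + γ ≤ R / c := by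
      rw [le_div_iff₀ hc]
      simp only [Pi.add_apply, Pi.smul_apply, smul_eq_mul] at hy0
      nlinarith [mul_le_mul_of_nonneg_left (hlow' p (by simp)) hα,
        mul_le_mul_of_nonneg_left (hlow' q (by simp)) hβ,
        mul_le_mul_of_nonneg_left (hlow' r (by simp)) hγ]
    refine le_trans ?_ (mul_le_mul_of_nonneg_left hs hM.le)
    simp only [mink_add_right, mink_smul_right]
    nlinarith [mul_le_mul_of_nonneg_left (hb p (by simp)) hα,
        mul_le_mul_of_nonneg_left (hb q (by simp)) hβ,
        mul_le_mul_of_nonneg_left (hb r (by simp)) hγ]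
  rw [le_div_iff₀ hη]
  refine le_trans ?_ hA
  have hs := hvn.self
  have hv0 := hvn.pos
  simp only [mink, hvn.flat] at hs ⊢
  have hcs : v 1 * y 1 + v 2 * y 2 ≤ v 0 * Real.sqrt (y 1 ^ 2 + y 2 ^ 2) := by
    refine (le_abs_self _).trans (abs_le_of_sq_le_sq ?_ (by positivity))
    rw [mul_pow, Real.sq_sqrt (by positivity)]
    nlinarith [sq_nonneg (v 1 * y 2 - v 2 * y 1), sq_nonneg (y 1), sq_nonneg (y 2)]
  nlinarith [mul_lt_mul_of_pos_left hyη hv0]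

theorem finite_faces (T : S.Triangulation) {x : V} (hx : Timelike x) :
    {Δ ∈ T.faces | x ∈ cone Δ}.Finite := by
  obtain ⟨F, hF, -, h⟩ := T.exists_finite_faces hx
  exact hF.subset fun Δ hΔ => h.self_of_nhds Δ hΔ.1 hΔ.2

theorem eventually_mem_cone (T : S.Triangulation) {x : V} (hx : Timelike x) :
    ∀ᶠ y in 𝓝 x, ∀ Δ ∈ T.faces, y ∈ cone Δ → x ∈ cone Δ := by
  obtain ⟨F, hF, hsub, h⟩ := T.exists_finite_faces hx
  have h1 : ∀ᶠ y in 𝓝 x, ∀ Δ ∈ F, y ∈ cone Δ → x ∈ cone Δ := by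
    rw [Filter.eventually_all_finite hF]
    intro Δ hΔ
    by_cases hxΔ : x ∈ cone Δ
    · exact Filter.Eventually.of_forall fun _ _ => hxΔ
    · filter_upwards [(isClosed_cone (hsub hΔ)).isOpen_compl.mem_nhds hxΔ] with y hy hy'
      exact absurd hy' hy
  filter_upwards [h, h1] with y hy hy1 Δ hΔ hyΔ
  exact hy1 Δ (hy Δ hΔ hyΔ) hyΔ

/-- Near a point of a triangle of `T'`, which may be an ideal vertex, all triangles of `T` that
meet this triangle contain the point. -/
theorem eventually_mem_cone_within (T : S.Triangulation) {T' : S.Triangulation} {Δ' : Set V}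
    (hΔ' : Δ' ∈ T'.faces) {u : V} (hu : u ∈ cone Δ') (hu0 : u ≠ 0) :
    ∀ᶠ y in 𝓝[cone Δ'] u, ∀ Δ ∈ T.faces, y ∈ cone Δ → u ∈ cone Δ := by
  rcases (causal_of_face hΔ' hu).timelike_or_null hu0 with ht | hn
  · exact (T.eventually_mem_cone ht).filter_mono nhdsWithin_le_nhds
  obtain ⟨α, a, b, c, hα, rfl, h, rfl⟩ := exists_vertex_of_null hΔ' hu hn
  obtain ⟨κ, hκ, hdeep⟩ := T.exists_depth
  have hal : a ∈ S.lifts := lift_mem hΔ' (by simp)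
  have hcont : Continuous fun y : V => det3 y b c / det3 a b c := by simp only [det3]; fun_prop
  have hαu : det3 (α • a) b c / det3 a b c = α := by
    have := (h.coords_combination α 0 0).1
    simpa using this
  have h1 : ∀ᶠ y in 𝓝 (α • a), 0 < det3 y b c / det3 a b c :=
    continuousAt_const.eventually_lt hcont.continuousAt (by rwa [hαu])
  -- If `a` is no vertex of `Δ`, then `exists_depth` and `mink y y ≤ 2 * A * mink a y`, where `A` is
  -- the `a`-coordinate of `y`, give `mink a y = 0` or `-mink a y ≥ 2 * A * κ`. The latter fails
  -- near `α • a`.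
  have h2 : ∀ᶠ y in 𝓝 (α • a), -mink a y < 2 * (det3 y b c / det3 a b c) * κ :=
    (continuous_mink_right a).neg.continuousAt.eventually_lt
      ((continuous_const.mul hcont).mul continuous_const).continuousAt
      (by rw [hαu, Pi.neg_apply, mink_smul_right, h.na.self]; simpa using mul_pos (mul_pos two_pos hα) hκ)
  filter_upwards [h1.filter_mono nhdsWithin_le_nhds, h2.filter_mono nhdsWithin_le_nhds,
    self_mem_nhdsWithin] with y hy1 hy2 hy3 Δ hΔ hyΔ
  refine cone_smul ?_ hα.le
  by_cases haΔ : a ∈ Δ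
  · exact subset_cone haΔ
  have hyc := causal_of_face hΔ hyΔ
  have hG := h.na.causal.mink_nonpos hyc
  have hd := hdeep Δ hΔ y hyΔ a hal haΔ
  obtain ⟨h3, -, hβ, hγ⟩ := h.mem_cone_iff.1 hy3
  set A := det3 y b c / det3 a b c
  set y' := (det3 a y c / det3 a b c) • b + (det3 a b y / det3 a b c) • c
  have hyy : y = A • a + y' := by rw [← add_assoc]; exact h.eq_combination h3
  have hy' : Causal y' := (h.nb.causal.smul hβ).add (h.nc.causal.smul hγ)
  have hself : mink y y ≤ 2 * A * mink a y := by
    have e1 : mink y y = 2 * A * mink a y' + mink y' y' := by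
      rw [hyy]
      simp only [mink_add_left, mink_add_right, mink_smul_left, mink_smul_right, h.na.self,
        mink_comm y' a]
      ring
    have e2 : mink a y = mink a y' := by
      rw [hyy, mink_add_right, mink_smul_right, h.na.self]; ring
    rw [e1, e2]; linarith [hy'.le]
  have hG0 : mink a y = 0 := by
    by_contra hne
    have hlt : mink a y < 0 := lt_of_le_of_ne hG hne
    nlinarith [mul_pos (neg_pos.2 hlt) (sub_pos.2 hy2), mul_le_mul_of_nonneg_left hself hκ.le]
  have hy0 : y ≠ 0 := by
    intro h0
    rw [show A = 0 by simp [A, h0, det3]] at hy1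
    exact lt_irrefl _ hy1
  rcases hyc.timelike_or_null hy0 with ht | hyn
  · have := ht.mink_neg_of_causal h.na.causal h.na.ne_zero
    rw [mink_comm, hG0] at this
    exact absurd this (lt_irrefl _)
  · have := hyn.proportional h.na (by rw [mink_comm, hG0])
    rw [this]
    exact cone_smul hyΔ (div_nonneg h.na.pos.le hyn.pos.le)

end Triangulation

end CuspSurface

/-! ### Normals of prisms, weights and dihedral angles -/

/-- Consequently the lateral edge at `v` has length `log (-mink m v)`, and a prescribed weight
becomes a linear condition on `m`. -/
theorem mink_foot {m v : V} (hm : mink m m = 1) (hv : mink v v = 0) (hneg : mink m v < 0) :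
    mink (foot m v) v = mink m v := by
  have e : -mink (v - mink v m • m) (v - mink v m • m) = mink m v ^ 2 := by
    simp only [mink_sub_left, mink_sub_right, mink_smul_left, mink_smul_right, hm, hv,
      mink_comm v m]
    ring
  rw [foot, e, Real.sqrt_sq_eq_abs, abs_of_neg hneg]
  simp only [mink_sub_left, mink_smul_left, hv, mink_comm v m]
  have := hneg.ne
  field_simp
  ring

/-- A vector is determined by its scalar products with the vertices of an ideal triangle, its norm
and the sign of its component orthogonal to the hyperbolic plane. -/
theorem IdealTriangle.ext_normal {a b c m m' : V} (h : IdealTriangle a b c) (hm : mink m m = 1)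
    (hm' : mink m' m' = 1) (h3 : 0 < m 3) (h3' : 0 < m' 3) (ha : mink m a = mink m' a)
    (hb : mink m b = mink m' b) (hc : mink m c = mink m' c) : m = m' := by
  obtain ⟨h0, h1, h2⟩ := eq_zero_of_det3 (d := m - m') h.na.flat h.nb.flat h.nc.flat h.det_ne_zero
    (by rw [mink_sub_left, ha, sub_self]) (by rw [mink_sub_left, hb, sub_self])
    (by rw [mink_sub_left, hc, sub_self])
  simp only [Pi.sub_apply, sub_eq_zero] at h0 h1 h2
  refine vec_ext h0 h1 h2 ?_
  simp only [mink, h0, h1, h2] at hm hm'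
  rw [← sq_eq_sq₀ h3.le h3'.le]
  linarith

/-- Expansion of the Minkowski product with respect to an edge and its unit normal. -/
theorem mink_expand {a b w m x : V} (ha : Null a) (hb : Null b) (hab : mink a b < 0)
    (hw : w 3 = 0) (hww : mink w w = 1) (hwa : mink w a = 0) (hwb : mink w b = 0) (hx : x 3 = 0) :
    mink m x = mink x b / mink a b * mink m a + mink x a / mink a b * mink m b
      + mink x w * mink m w := by
  conv_lhs => rw [expand_null ha hb hab hw hww hwa hwb hx]
  rw [mink_add_right, mink_add_right, mink_smul_right, mink_smul_right, mink_smul_right]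

/-- Pythagoras for the orthogonal splitting into the span of `a`, `b` and the lines of `w` and `e₃`.
For a unit vector, `mink m w ^ 2 + m 3 ^ 2` depends only on the values at the edge. -/
theorem mink_self_expand {a b w m : V} (ha : Null a) (hb : Null b) (hab : mink a b < 0)
    (hw : w 3 = 0) (hww : mink w w = 1) (hwa : mink w a = 0) (hwb : mink w b = 0) :
    mink m m = 2 * mink m a * mink m b / mink a b + mink m w ^ 2 + m 3 ^ 2 := by
  have hflat : ∀ y : V, y 3 = 0 → mink (m - m 3 • e₃) y = mink m y := fun y hy => by
    rw [mink_sub_left, mink_smul_left, mink_e₃_left, hy]; ring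
  have h1 := mink_expand (m := m) (x := m - m 3 • e₃) ha hb hab hw hww hwa hwb (by simp [e₃])
  rw [hflat b hb.flat, hflat a ha.flat, hflat w hw, mink_sub_right, mink_smul_right,
    mink_e₃_right] at h1
  linear_combination h1

/-- The outer normal of a lateral face. -/
theorem isLateralOuterNormal {a b c w m : V} (ha : a 3 = 0) (hb : b 3 = 0) (hc : c 3 = 0)
    (hw : w 3 = 0) (hww : mink w w = 1) (hwa : mink w a = 0) (hwb : mink w b = 0)
    (hwc : mink w c < 0) (hm : 0 < m 3) :
    IsLateralOuterNormal {a, b, c} {a, b} m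
      ((Real.sqrt (m 3 ^ 2 + mink m w ^ 2))⁻¹ • (m 3 • w - mink m w • e₃)) := by
  have hD : 0 < m 3 ^ 2 + mink m w ^ 2 := by positivity
  have hs := Real.sqrt_pos.2 hD
  have key : ∀ y : V, y 3 = 0 →
      mink ((Real.sqrt (m 3 ^ 2 + mink m w ^ 2))⁻¹ • (m 3 • w - mink m w • e₃)) y =
      (Real.sqrt (m 3 ^ 2 + mink m w ^ 2))⁻¹ * (m 3 * mink w y) := fun y hy => by
    rw [mink_smul_left, mink_sub_left, mink_smul_left, mink_smul_left, mink_e₃_left, hy]; ring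
  refine ⟨?_, ?_, ?_, ?_⟩
  · rw [mink_smul_left, mink_smul_right]
    simp only [mink_sub_left, mink_sub_right, mink_smul_left, mink_smul_right, mink_e₃_left,
      mink_e₃_right, hww, hw]
    have h3 : (e₃ : V) 3 = 1 := by simp [e₃]
    simp only [Pi.sub_apply, Pi.smul_apply, smul_eq_mul, h3, hw]
    rw [← mul_assoc, ← mul_inv, Real.mul_self_sqrt hD.le, inv_mul_eq_one₀ hD.ne']
    ring
  · intro v hv
    rcases hv with rfl | rfl
    · rw [key _ ha, hwa]; ring
    · rw [key _ hb, hwb]; ring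
  · rw [mink_smul_left, mink_sub_left, mink_smul_left, mink_smul_left, mink_e₃_left, mink_comm w m]
    ring
  · rintro v ⟨hv, hve⟩
    rcases hv with rfl | rfl | rfl
    · exact absurd (by simp) hve
    · exact absurd (by simp) hve
    · rw [key _ hc]
      exact mul_neg_of_pos_of_neg (inv_pos.2 hs) (mul_neg_of_pos_of_neg hm hwc)

/-- The dihedral angle with the upper face is `arccos (ν 3)`, so the hypothesis reads `arccos (ν 3)
≤ arccos (-ν' 3)`, and `arccos` is decreasing. -/
theorem add_nonneg_of_dihedralAngle {ν ν' : V} (h : |ν 3| ≤ 1) (h' : |ν' 3| ≤ 1)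
    (hle : dihedralAngle (-e₃) ν + dihedralAngle (-e₃) ν' ≤ Real.pi) : 0 ≤ ν 3 + ν' 3 := by
  simp only [dihedralAngle, mink_neg_left, mink_e₃_left, Real.arccos_neg] at hle
  by_contra hlt
  rw [abs_le] at h h'
  have := Real.strictAntiOn_arccos (show ν 3 ∈ Set.Icc (-1) 1 from h)
    (show -ν' 3 ∈ Set.Icc (-1) 1 from ⟨by linarith [h'.2], by linarith [h'.1]⟩) (by linarith)
  rw [Real.arccos_neg] at this
  linarith

namespace CuspSurface

variable {n : ℕ} {S : CuspSurface n}

namespace Triangulation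

variable {T T' : S.Triangulation} {r : Fin n → ℝ}

namespace Admissible

theorem normal_spec (h : T.Admissible r) (Δ : T.faces) : S.IsPrismOver r Δ (h.normal Δ) :=
  (h Δ Δ.2).choose_spec

theorem normal_self (h : T.Admissible r) (Δ : T.faces) : mink (h.normal Δ) (h.normal Δ) = 1 :=
  (h.normal_spec Δ).1.unit

theorem normal_pos (h : T.Admissible r) (Δ : T.faces) : 0 < h.normal Δ 3 :=
  (h.normal_spec Δ).1.pos

theorem mink_normal (h : T.Admissible r) (Δ : T.faces) {v : V} (hv : v ∈ (Δ : Set V)) {i : Fin n}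
    (hi : S.IsLift i v) : mink (h.normal Δ) v = -Real.exp (r i) := by
  obtain ⟨h1, h2⟩ := h.normal_spec Δ
  have h3 := h2 v hv i hi
  have hneg := h1.side v hv
  rw [horoDist, mink_foot h1.unit hi.null.self hneg] at h3
  rw [← h3, Real.exp_log (neg_pos.2 hneg), neg_neg]

theorem mink_normal_eq (h : T.Admissible r) (h' : T'.Admissible r) (Δ : T.faces) (Δ' : T'.faces)
    {v : V} (hv : v ∈ (Δ : Set V)) (hv' : v ∈ (Δ' : Set V)) :
    mink (h.normal Δ) v = mink (h'.normal Δ') v := by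
  obtain ⟨i, hi⟩ := lift_mem Δ.2 hv
  rw [h.mink_normal Δ hv hi, h'.mink_normal Δ' hv' hi]

theorem normal_eq (h : T.Admissible r) (h' : T'.Admissible r) (Δ : T.faces) (Δ' : T'.faces)
    (heq : ∀ v ∈ (Δ : Set V), mink (h.normal Δ) v = mink (h'.normal Δ') v) :
    h.normal Δ = h'.normal Δ' := by
  obtain ⟨a, b, c, ht, hΔ⟩ := exists_vertices Δ.2
  rw [hΔ] at heq
  exact ht.ext_normal (h.normal_self Δ) (h'.normal_self Δ') (h.normal_pos Δ) (h'.normal_pos Δ')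
    (heq a (by simp)) (heq b (by simp)) (heq c (by simp))

/-- The image of a triangle under a deck transformation. -/
def _root_.Prismatic.CuspSurface.Triangulation.translate (T : S.Triangulation) {γ : V ≃ₗ[ℝ] V}
    (hγ : γ ∈ S.Γ) (Δ : T.faces) : T.faces :=
  ⟨γ '' (Δ : Set V), T.invariant γ hγ Δ Δ.2⟩

/-- The normal is obtained by choice, but it is determined by its values at the vertices, and these
are invariant weights. -/
theorem normal_translate (h : T.Admissible r) {γ : V ≃ₗ[ℝ] V} (hγ : γ ∈ S.Γ) (Δ : T.faces) :
    h.normal (T.translate hγ Δ) = γ (h.normal Δ) := by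
  obtain ⟨a, b, c, ht, hΔ⟩ := exists_vertices (T.translate hγ Δ).2
  have key : ∀ w ∈ ((T.translate hγ Δ : T.faces) : Set V),
      mink (h.normal (T.translate hγ Δ)) w = mink (γ (h.normal Δ)) w := by
    rintro _ ⟨v, hv, rfl⟩
    obtain ⟨i, hi⟩ := lift_mem Δ.2 hv
    rw [S.mink_map γ hγ, h.mink_normal Δ hv hi,
      h.mink_normal (T.translate hγ Δ) (i := i) ⟨v, hv, rfl⟩ (hi.apply hγ)]
  rw [hΔ] at key
  exact ht.ext_normal (h.normal_self _) (by rw [S.mink_map γ hγ, h.normal_self])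
    (h.normal_pos _) (by rw [apply_flat hγ]; exact h.normal_pos Δ)
    (key a (by simp)) (key b (by simp)) (key c (by simp))

end Admissible

/-- The vertices opposite to a common edge lie on different sides of this edge. -/
theorem exists_edge_normal {a b c d : V} (hc : {a, b, c} ∈ T.faces) (hd : {a, b, d} ∈ T.faces)
    (hcd : ({a, b, c} ∩ {a, b, d} : Set V) = {a, b}) (htc : IdealTriangle a b c)
    (htd : IdealTriangle a b d) : ∃ w : V, w 3 = 0 ∧ mink w w = 1 ∧ mink w a = 0 ∧ mink w b = 0 ∧
      mink w c < 0 ∧ 0 < mink w d := by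
  obtain ⟨w, hw, hww, hwc⟩ : ∃ w : V, (w 3 = 0 ∧ mink w w = 1 ∧ mink w a = 0 ∧ mink w b = 0) ∧
      mink w c < 0 ∧ mink w d ≠ 0 := by
    obtain ⟨w, hw, hww, hwa, hwb⟩ := exists_unit_normal htc.na htc.nb htc.ab
    have key : ∀ c, IdealTriangle a b c → mink w c ≠ 0 := fun c ht h0 => by
      obtain ⟨h0, h1, h2⟩ := eq_zero_of_det3 ht.na.flat ht.nb.flat ht.nc.flat ht.det_ne_zero
        hwa hwb h0
      simp [mink, h0, h1, h2, hw] at hww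
    rcases (key c htc).lt_or_gt with h | h
    · exact ⟨w, ⟨hw, hww, hwa, hwb⟩, h, key d htd⟩
    · exact ⟨-w, by simp [mink_neg_left, mink_neg_right, *], by simpa [mink_neg_left],
        by simpa [mink_neg_left] using key d htd⟩
  obtain ⟨hw3, hw1, hwa, hwb⟩ := hw
  refine ⟨w, hw3, hw1, hwa, hwb, hww, ?_⟩
  by_contra hle
  have hlt : mink w d < 0 := lt_of_le_of_ne (not_lt.1 hle) hwc
  have hd' := htc.eq_combination htd.nc.flat
  set α := det3 d b c / det3 a b c
  set β := det3 a d c / det3 a b c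
  set γ := det3 a b d / det3 a b c
  have hγ : 0 < γ := by
    have e : mink w d = γ * mink w c := by
      conv_lhs => rw [hd']
      simp only [mink_add_right, mink_smul_right, hwa, hwb]; ring
    by_contra hγ
    rw [e] at hlt
    nlinarith
  -- If `d` is on the side of `c`, then for this small `ε` the vector `a + b + ε • d` lies in both
  -- cones but not in the cone over the common edge.
  set ε := (1 + |α| + |β|)⁻¹
  have hpos : 0 < 1 + |α| + |β| := by positivity
  have hε : 0 < ε := inv_pos.2 hpos
  have hεm : ε * (1 + |α| + |β|) = 1 := inv_mul_cancel₀ hpos.ne'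
  have hεα : 0 ≤ 1 + ε * α := by
    nlinarith [neg_abs_le α, mul_nonneg hε.le (abs_nonneg β)]
  have hεβ : 0 ≤ 1 + ε * β := by
    nlinarith [neg_abs_le β, mul_nonneg hε.le (abs_nonneg α)]
  have hx : a + b + ε • d = (1 + ε * α) • a + (1 + ε * β) • b + (ε * γ) • c := by
    conv_lhs => rw [hd']
    module
  have h1 : a + b + ε • d ∈ cone {a, b, c} :=
    hx ▸ combination_mem_cone hεα hεβ (mul_pos hε hγ).le
  have h2 : a + b + ε • d ∈ cone {a, b, d} := by
    simpa using combination_mem_cone (a := a) (b := b) (c := d) zero_le_one zero_le_one hε.le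
  have ht : Timelike (a + b + ε • d) :=
    (htd.na.causal.add_timelike htd.nb.causal htd.ab).add_causal (htd.nc.causal.smul hε.le)
  have h3 := mem_cone_inter ht hc hd h1 h2
  rw [hcd] at h3
  obtain ⟨p, q, -, -, hpq⟩ := mem_cone_pair h3
  have h4 := congrArg (mink w) hpq
  simp only [mink_add_right, mink_smul_right, hwa, hwb] at h4
  nlinarith

/-- The support functions of two adjacent triangles of a convex pair. -/
theorem IsConvexPair.local_support (h : T.IsConvexPair r) {x : V} (hx : Timelike x)
    (Δ Δ' : T.faces) (hΔ : x ∈ cone (Δ : Set V)) (hΔ' : x ∈ cone (Δ' : Set V)) {y : V}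
    (hy : y ∈ cone (Δ' : Set V)) :
    mink (h.admissible.normal Δ) y ≤ mink (h.admissible.normal Δ') y := by
  by_cases hne : Δ = Δ'
  · rw [hne]
  obtain ⟨a, b, c, d, he, hc, hd, htc, htd⟩ := exists_common_edge hx Δ.2 Δ'.2
    (fun h => hne (Subtype.ext h)) hΔ hΔ'
  obtain ⟨w, hw, hww, hwa, hwb, hwc, hwd⟩ := exists_edge_normal (T := T) (hc ▸ Δ.2) (hd ▸ Δ'.2)
    (by rw [← hc, ← hd, he]) htc htd
  set m := h.admissible.normal Δ with hm
  set m' := h.admissible.normal Δ' with hm'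
  have ha : mink m a = mink m' a := h.admissible.mink_normal_eq h.admissible Δ Δ'
    (by rw [hc]; simp) (by rw [hd]; simp)
  have hb : mink m b = mink m' b := h.admissible.mink_normal_eq h.admissible Δ Δ'
    (by rw [hc]; simp) (by rw [hd]; simp)
  have hp := h.admissible.normal_pos Δ
  have hp' := h.admissible.normal_pos Δ'
  have hn := isLateralOuterNormal htc.na.flat htc.nb.flat htc.nc.flat hw hww hwa hwb hwc hp
  have hn' := isLateralOuterNormal (c := d) (w := -w) (m := m') htd.na.flat htd.nb.flat htd.nc.flat
    (by simp [hw]) (by simp [mink_neg_left, mink_neg_right, hww]) (by simp [mink_neg_left, hwa])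
    (by simp [mink_neg_left, hwb]) (by simpa [mink_neg_left] using hwd) hp'
  -- The two normals agree on the edge, so the outer normals of the two lateral faces have the same
  -- normalising factor. The angle condition then becomes the comparison `mink m w ≤ mink m' w` of
  -- the slopes across the edge.
  have hS : m 3 ^ 2 + mink m w ^ 2 = m' 3 ^ 2 + mink m' w ^ 2 := by
    have e1 := mink_self_expand (m := m) htc.na htc.nb htc.ab hw hww hwa hwb
    have e2 := mink_self_expand (m := m') htc.na htc.nb htc.ab hw hww hwa hwb
    rw [h.admissible.normal_self] at e1 e2
    rw [ha, hb] at e1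
    linarith
  have hangle := h.convex Δ Δ' hne {a, b} (Set.ncard_pair fun hab => by
      have := htc.ab; rw [hab, htc.nb.self] at this; exact lt_irrefl _ this)
    (by rw [hc]; simp [Set.insert_subset_iff]) (by rw [hd]; simp [Set.insert_subset_iff]) _ _
    (by rw [hc]; exact hn) (by rw [hd]; exact hn')
  have hpos : 0 < m 3 ^ 2 + mink m w ^ 2 := by positivity
  have hsq := Real.sqrt_pos.2 hpos
  have h3 : (e₃ : V) 3 = 1 := by simp [e₃]
  have hbound : ∀ t : ℝ, t ^ 2 ≤ m 3 ^ 2 + mink m w ^ 2 →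
      |(Real.sqrt (m 3 ^ 2 + mink m w ^ 2))⁻¹ * t| ≤ 1 := fun t ht => by
    rw [abs_mul, abs_of_pos (inv_pos.2 hsq), inv_mul_le_one₀ hsq]
    exact Real.abs_le_sqrt ht
  have hv : ((Real.sqrt (m 3 ^ 2 + mink m w ^ 2))⁻¹ • (m 3 • w - mink m w • e₃)) 3 =
      (Real.sqrt (m 3 ^ 2 + mink m w ^ 2))⁻¹ * -mink m w := by
    simp [hw, h3]
  have hv' : ((Real.sqrt (m' 3 ^ 2 + mink m' (-w) ^ 2))⁻¹ • (m' 3 • -w - mink m' (-w) • e₃)) 3 =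
      (Real.sqrt (m 3 ^ 2 + mink m w ^ 2))⁻¹ * mink m' w := by
    rw [mink_neg_right, neg_sq, ← hS]; simp [hw, h3]
  have hsum := add_nonneg_of_dihedralAngle
    (by rw [hv]; exact hbound _ (by nlinarith [sq_nonneg (m 3)]))
    (by rw [hv']; exact hbound _ (by rw [hS]; nlinarith [sq_nonneg (m' 3)])) hangle
  rw [hv, hv', ← mul_add] at hsum
  have hle : mink m w ≤ mink m' w := by
    have := nonneg_of_mul_nonneg_right hsum (inv_pos.2 hsq)
    linarith
  refine mink_le_of_mem_cone (fun v hv => ?_) hy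
  rw [hd] at hv
  rcases hv with rfl | rfl | rfl
  · exact ha.le
  · exact hb.le
  · rw [mink_expand (m := m) htc.na htc.nb htc.ab hw hww hwa hwb htd.nc.flat,
      mink_expand (m := m') htc.na htc.nb htc.ab hw hww hwa hwb htd.nc.flat, ha, hb]
    rw [mink_comm] at hwd
    nlinarith

end Triangulation

end CuspSurface

/-! ### Global concavity and uniqueness of the piecewise linear function -/

theorem IdealTriangle.timelike_sum {a b c : V} (h : IdealTriangle a b c) : Timelike (a + b + c) :=
  (h.na.causal.add_timelike h.nb.causal h.ab).add_causal h.nc.causal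

/-- A cubic polynomial with zeros accumulating at `0` vanishes. -/
theorem cubic_eq_zero {k₀ k₁ k₂ k₃ : ℝ}
    (h : ∃ᶠ ε : ℝ in 𝓝[>] 0, k₀ + ε * k₁ + ε ^ 2 * k₂ + ε ^ 3 * k₃ = 0) :
    k₁ = 0 ∧ k₂ = 0 ∧ k₃ = 0 := by
  open Polynomial in
  let p : ℝ[X] := C k₀ + X * C k₁ + X ^ 2 * C k₂ + X ^ 3 * C k₃
  have hp : p = 0 := by
    refine Polynomial.eq_zero_of_infinite_isRoot p ?_
    rw [← Filter.frequently_cofinite_mem_iff_infinite]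
    refine (h.filter_mono ((nhdsWithin_mono 0
      (show Set.Ioi (0 : ℝ) ⊆ {0}ᶜ from fun x hx => ne_of_gt hx)).trans
      (nhdsNE_le_cofinite 0))).mono fun ε hε => ?_
    change p.eval ε = 0
    simp only [p, Polynomial.eval_add, Polynomial.eval_mul, Polynomial.eval_C, Polynomial.eval_X,
      Polynomial.eval_pow]
    exact hε
  refine ⟨?_, ?_, ?_⟩
  · simpa [p, Polynomial.coeff_X, Polynomial.coeff_X_pow, Polynomial.coeff_C] using
      congrArg (fun q => Polynomial.coeff q 1) hp
  · simpa [p, Polynomial.coeff_X, Polynomial.coeff_X_pow, Polynomial.coeff_C] using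
      congrArg (fun q => Polynomial.coeff q 2) hp
  · simpa [p, Polynomial.coeff_X, Polynomial.coeff_X_pow, Polynomial.coeff_C] using
      congrArg (fun q => Polynomial.coeff q 3) hp

namespace CuspSurface

variable {n : ℕ} {S : CuspSurface n}

namespace Triangulation

variable {T T' : S.Triangulation} {r : Fin n → ℝ}

/-- The support functions of a convex pair are globally supporting: the piecewise linear function
given by the pair is concave. -/
theorem IsConvexPair.support (h : T.IsConvexPair r) {x y : V} (hx : Timelike x) (hy : Timelike y)
    (Δ Δ' : T.faces) (hΔ : x ∈ cone (Δ : Set V)) (hΔ' : y ∈ cone (Δ' : Set V)) :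
    mink (h.admissible.normal Δ) y ≤ mink (h.admissible.normal Δ') y := by
  -- The claim is propagated along the segment from `y` at time `0` to `x` at time `1`, for all
  -- triangles that contain `p t`.
  let p : ℝ → V := fun t => (1 - t) • y + t • x
  have hpc : Continuous p := by fun_prop
  have hpt : ∀ t ∈ Set.Icc (0 : ℝ) 1, Timelike (p t) := by
    rintro t ⟨h0, h1⟩
    rcases h1.lt_or_eq with h1 | rfl
    · exact (hy.smul (sub_pos.2 h1)).add_causal (hx.causal.smul h0)
    · simpa [p] using hx
  have hnear : ∀ t ∈ Set.Icc (0 : ℝ) 1, ∀ᶠ s in 𝓝 t, ∀ Δ ∈ T.faces, p s ∈ cone Δ → p t ∈ cone Δ :=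
    fun t ht => hpc.continuousAt.eventually (T.eventually_mem_cone (hpt t ht))
  have main := real_induction (a := 0) (b := 1) (P := fun t => ∀ Δ : T.faces, p t ∈ cone (Δ : Set V) →
      mink (h.admissible.normal Δ) y ≤ mink (h.admissible.normal Δ') y) ?_ ?_ ?_
  · exact main 1 ⟨zero_le_one, le_rfl⟩ Δ (by simpa [p] using hΔ)
  · intro Δ hΔ
    exact h.local_support hy Δ Δ' (by simpa [p] using hΔ) hΔ' hΔ'
  · intro t ht hP
    filter_upwards [(hnear t ⟨ht.1, ht.2.le⟩).filter_mono nhdsWithin_le_nhds] with s hs Δ hΔ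
    exact hP Δ (hs Δ Δ.2 hΔ)
  · intro t ht hP Δ hΔ
    have htt := hpt t ⟨ht.1.le, ht.2⟩
    obtain ⟨s, hs, hst⟩ := (((hnear t ⟨ht.1.le, ht.2⟩).filter_mono
      (nhdsWithin_le_nhds (s := Set.Iio t))).and (Ico_mem_nhdsLT ht.1)).exists
    obtain ⟨Δs, hΔs, hps⟩ := T.exists_face (hpt s ⟨hst.1, hst.2.le.trans ht.2⟩)
    have hts := hs Δs hΔs hps
    refine le_trans ?_ (hP s hst ⟨Δs, hΔs⟩ hps)
    have e1 := h.local_support htt Δ ⟨Δs, hΔs⟩ hΔ hts hps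
    have e2 := h.local_support htt ⟨Δs, hΔs⟩ Δ hts hΔ hΔ
    -- The function `mink (normal Δ) - mink (normal Δs)` is at most `0` at `p s` and at least `0` at
    -- `p t`. As `p s` lies between `y` and `p t`, it is at most `0` at `y`.
    have hcomb : t • p s = (t - s) • y + s • p t := by
      simp only [p]; module
    have e3 : ∀ m, t * mink m (p s) = (t - s) * mink m y + s * mink m (p t) := fun m => by
      rw [← mink_smul_right, hcomb, mink_add_right, mink_smul_right, mink_smul_right]
    have e4 := mul_le_mul_of_nonneg_left e1 ht.1.le
    rw [e3, e3] at e4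
    have e5 := mul_le_mul_of_nonneg_left e2 hst.1
    exact le_of_mul_le_mul_left (by linarith) (sub_pos.2 hst.2)

/-- The support functions also dominate the weights at the cusps. -/
theorem IsConvexPair.support_lift (h : T.IsConvexPair r) (Δ : T.faces) {w : V} {i : Fin n}
    (hw : S.IsLift i w) : mink (h.admissible.normal Δ) w ≤ -Real.exp (r i) := by
  obtain ⟨a, b, c, ht, hΔ⟩ := exists_vertices Δ.2
  obtain ⟨κ, hκ, hdeep⟩ := T.exists_depth
  set x := a + b + c
  have hxΔ : x ∈ cone (Δ : Set V) := by
    rw [hΔ]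
    exact cone_add (cone_add (subset_cone (by simp)) (subset_cone (by simp)))
      (subset_cone (by simp))
  have hx : Timelike x := ht.timelike_sum
  have hG := hx.mink_neg_of_causal hw.null.causal hw.null.ne_zero
  -- This multiple of `w` moves `x` so deep into the horoball that `exists_depth` forces `w` to be a
  -- vertex of the triangle reached.
  set y := x + (-mink x w / κ) • w
  have hy : Timelike y :=
    hx.add_causal (hw.null.causal.smul (div_nonneg (neg_pos.2 hG).le hκ.le))
  obtain ⟨Δy, hΔy, hyΔ⟩ := T.exists_face hy
  have hwΔ : w ∈ Δy := by
    by_contra hwΔ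
    have h1 := hdeep Δy hΔy y hyΔ w ⟨i, hw⟩ hwΔ
    have e1 : mink w y = mink x w := by
      simp only [y, mink_add_right, mink_smul_right, hw.null.self, mink_comm w x]; ring
    have e2 : mink y y = mink x x + 2 * (-mink x w / κ) * mink x w := by
      simp only [y, mink_add_right, mink_add_left, mink_smul_left, mink_smul_right, hw.null.self,
        mink_comm w x]
      ring
    have e3 : κ * -mink y y = κ * -mink x x + 2 * mink x w ^ 2 := by
      rw [e2]; field_simp; ring
    rw [e1, e3] at h1
    nlinarith [mul_pos hκ (neg_pos.2 hx.neg), mul_pos_of_neg_of_neg hG hG]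
  -- The ray from `y` in direction `w` stays in one cone, so letting `τ` grow in the support
  -- inequality compares the values at `w`.
  have key : ∀ τ : ℝ, 0 ≤ τ → mink (h.admissible.normal Δ) y + τ * mink (h.admissible.normal Δ) w ≤
      mink (h.admissible.normal ⟨Δy, hΔy⟩) y + τ * -Real.exp (r i) := fun τ hτ => by
    have := h.support hx (hy.add_causal (hw.null.causal.smul hτ)) Δ ⟨Δy, hΔy⟩ hxΔ
      (cone_add hyΔ (cone_smul (subset_cone hwΔ) hτ))
    rwa [mink_add_right _ y, mink_add_right _ y, mink_smul_right, mink_smul_right,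
      h.admissible.mink_normal ⟨Δy, hΔy⟩ hwΔ hw] at this
  by_contra hlt
  push Not at hlt
  set A := mink (h.admissible.normal Δ) w + Real.exp (r i)
  have hA : 0 < A := by simp only [A]; linarith
  set B := mink (h.admissible.normal ⟨Δy, hΔy⟩) y - mink (h.admissible.normal Δ) y
  have h1 := key ((|B| + 1) / A) (by positivity)
  have h2 : (|B| + 1) / A * A = |B| + 1 := div_mul_cancel₀ _ hA.ne'
  have h3 : (|B| + 1) / A * A ≤ B := by simp only [A, B] at h1 ⊢; linarith
  linarith [le_abs_self B]

/-- The piecewise linear functions of two convex pairs with the same weights coincide. -/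
theorem IsConvexPair.mink_normal_eq (h : T.IsConvexPair r) (h' : T'.IsConvexPair r) (Δ : T.faces)
    (Δ' : T'.faces) {y : V} (hy : y ∈ cone (Δ : Set V)) (hy' : y ∈ cone (Δ' : Set V)) :
    mink (h.admissible.normal Δ) y = mink (h'.admissible.normal Δ') y := by
  apply le_antisymm
  -- Comparison at the vertices of `Δ'` suffices, and there `mink (normal Δ')` takes the prescribed
  -- values.
  · refine mink_le_of_mem_cone (fun w hw => ?_) hy'
    obtain ⟨i, hi⟩ := lift_mem Δ'.2 hw
    rw [h'.admissible.mink_normal Δ' hw hi]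
    exact h.support_lift Δ hi
  · refine mink_le_of_mem_cone (fun w hw => ?_) hy
    obtain ⟨i, hi⟩ := lift_mem Δ.2 hw
    rw [h.admissible.mink_normal Δ hw hi]
    exact h'.support_lift Δ' hi

/-- The curve `u + ε • a + ε ^ 2 • b + ε ^ 3 • c` runs inside the cone of `Δ`. Only finitely many
triangles of `T'` matter near `u`, so one of them contains the curve for arbitrarily small `ε > 0`.
Along the curve the difference of the two linear functions is a cubic polynomial in `ε` that has
these zeros, and its higher coefficients are the differences at the vertices. -/
theorem IsConvexPair.exists_same_normal_of_timelike (h : T.IsConvexPair r)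
    (h' : T'.IsConvexPair r) (Δ : T.faces) {u : V} (hu : u ∈ cone (Δ : Set V)) (ht : Timelike u) :
    ∃ Δ' : T'.faces, u ∈ cone (Δ' : Set V) ∧ h'.admissible.normal Δ' = h.admissible.normal Δ := by
  obtain ⟨a, b, c, htri, hΔ⟩ := exists_vertices Δ.2
  have ha : a ∈ (Δ : Set V) := by rw [hΔ]; simp
  have hb : b ∈ (Δ : Set V) := by rw [hΔ]; simp
  have hc : c ∈ (Δ : Set V) := by rw [hΔ]; simp
  let p : ℝ → V := fun ε => u + ε • a + ε ^ 2 • b + ε ^ 3 • c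
  have hpc : Continuous p := by fun_prop
  have hp0 : p 0 = u := by simp [p]
  have hev : ∀ᶠ ε in 𝓝[>] (0 : ℝ), p ε ∈ cone (Δ : Set V) ∧
      ∃ Δ' ∈ {Δ' ∈ T'.faces | u ∈ cone Δ'}, p ε ∈ cone Δ' := by
    have h1 : ∀ᶠ ε in 𝓝 (0 : ℝ), ∀ Δ' ∈ T'.faces, p ε ∈ cone Δ' → u ∈ cone Δ' :=
      hpc.continuousAt.eventually (by rw [hp0]; exact T'.eventually_mem_cone ht)
    filter_upwards [h1.filter_mono nhdsWithin_le_nhds, self_mem_nhdsWithin] with ε hε hpos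
    have hpos : 0 < ε := hpos
    have hpt : Timelike (p ε) := ((ht.add_causal (htri.na.causal.smul hpos.le)).add_causal
      (htri.nb.causal.smul (by positivity))).add_causal (htri.nc.causal.smul (by positivity))
    obtain ⟨Δ', hΔ', hpΔ'⟩ := T'.exists_face hpt
    exact ⟨cone_add (cone_add (cone_add hu (cone_smul (subset_cone ha) hpos.le))
      (cone_smul (subset_cone hb) (by positivity))) (cone_smul (subset_cone hc) (by positivity)),
      Δ', ⟨hΔ', hε Δ' hΔ' hpΔ'⟩, hpΔ'⟩
  obtain ⟨Δ', hΔ', hfreq⟩ : ∃ Δ' ∈ {Δ' ∈ T'.faces | u ∈ cone Δ'},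
      ∃ᶠ ε in 𝓝[>] (0 : ℝ), p ε ∈ cone (Δ : Set V) ∧ p ε ∈ cone Δ' := by
    by_contra! hcon
    obtain ⟨ε, h1, h2, Δ', h3, h4⟩ :=
      (((Filter.eventually_all_finite (T'.finite_faces ht)).2 hcon).and  hev).exists
    exact h1 Δ' h3 h2 h4
  refine ⟨⟨Δ', hΔ'.1⟩, hΔ'.2, (Admissible.normal_eq h.admissible h'.admissible Δ _ ?_).symm⟩
  set m := h.admissible.normal Δ
  set m' := h'.admissible.normal ⟨Δ', hΔ'.1⟩
  obtain ⟨e1, e2, e3⟩ := cubic_eq_zero (k₀ := mink (m - m') u) (k₁ := mink (m - m') a)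
    (k₂ := mink (m - m') b) (k₃ := mink (m - m') c) (hfreq.mono fun ε hε => by
      have := h.mink_normal_eq h' Δ ⟨Δ', hΔ'.1⟩ hε.1 hε.2
      rw [← sub_eq_zero, ← mink_sub_left] at this
      simpa only [p, mink_add_right, mink_smul_right] using this)
  simp only [mink_sub_left, sub_eq_zero] at e1 e2 e3
  intro v hv
  rw [hΔ] at hv
  rcases hv with rfl | rfl | rfl
  · exact e1
  · exact e2
  · exact e3

/-- Each point of a triangle of a convex pair lies in a triangle with the same support function
of any other convex pair with the same weights. -/
theorem IsConvexPair.exists_same_normal (h : T.IsConvexPair r) (h' : T'.IsConvexPair r)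
    (Δ : T.faces) {u : V} (hu : u ∈ cone (Δ : Set V)) (hu0 : u ≠ 0) :
    ∃ Δ' : T'.faces, u ∈ cone (Δ' : Set V) ∧ h'.admissible.normal Δ' = h.admissible.normal Δ := by
  obtain ⟨a, b, c, htri, hΔ⟩ := exists_vertices Δ.2
  have hz : a + b + c ∈ cone (Δ : Set V) := by
    rw [hΔ]
    exact cone_add (cone_add (subset_cone (by simp)) (subset_cone (by simp)))
      (subset_cone (by simp))
  -- Moving into the triangle makes the vector timelike. For small `ε` the triangle of `T'` found
  -- there still contains `u`, even if `u` is an ideal vertex.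
  let p : ℝ → V := fun ε => u + ε • (a + b + c)
  have hpc : Continuous p := by fun_prop
  have hp0 : p 0 = u := by simp [p]
  have htend : Filter.Tendsto p (𝓝[>] 0) (𝓝[cone (Δ : Set V)] u) := by
    refine tendsto_nhdsWithin_iff.2 ⟨?_, ?_⟩
    · have := hpc.tendsto 0
      rw [hp0] at this
      exact this.mono_left nhdsWithin_le_nhds
    · filter_upwards [self_mem_nhdsWithin] with ε hε
      exact cone_add hu (cone_smul hz (le_of_lt hε))
  obtain ⟨ε, hε, hpos⟩ := ((htend.eventually
    (T'.eventually_mem_cone_within Δ.2 hu hu0)).and self_mem_nhdsWithin).exists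
  have hpos : 0 < ε := hpos
  have hpt : Timelike (p ε) := by
    simp only [p]
    rw [add_comm]
    exact (htri.timelike_sum.smul hpos).add_causal (causal_of_face Δ.2 hu)
  obtain ⟨Δ', h1, h2⟩ := h.exists_same_normal_of_timelike h' Δ
    (cone_add hu (cone_smul hz hpos.le)) hpt
  exact ⟨Δ', hε Δ' Δ'.2 h1, h2⟩

end Triangulation

end CuspSurface

/-! ### Points of prisms -/

theorem mink_neg_of_mem_H3 {x u : V} (hx : x ∈ H3) (hu : Causal u) (hu0 : u ≠ 0) :
    mink x u < 0 := by
  obtain ⟨hx, hx0⟩ := hx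
  have h0 : 0 < u 0 := lt_of_le_of_ne hu.nonneg fun h0 => hu0 (hu.eq_zero h0.symm)
  have hl := hu.le
  simp only [mink, hu.flat] at *
  have h1 : (x 1 * u 1 + x 2 * u 2) ^ 2 < (x 0 * u 0) ^ 2 := by
    have h2 : (x 1 ^ 2 + x 2 ^ 2) * (u 1 ^ 2 + u 2 ^ 2) ≤ (x 1 ^ 2 + x 2 ^ 2) * u 0 ^ 2 :=
      mul_le_mul_of_nonneg_left (by linarith) (by positivity)
    have h3 : (x 1 ^ 2 + x 2 ^ 2) * u 0 ^ 2 < x 0 ^ 2 * u 0 ^ 2 :=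
      mul_lt_mul_of_pos_right (by nlinarith [sq_nonneg (x 3)]) (by positivity)
    nlinarith [sq_nonneg (x 1 * u 2 - x 2 * u 1)]
  have h2 := abs_lt_of_sq_lt_sq h1 (mul_pos hx0 h0).le
  linarith [(abs_lt.1 h2).2]

theorem mem_H3_of_mink_neg {x u : V} (hx : mink x x = -1) (hu : Causal u) (h : mink x u < 0) :
    x ∈ H3 := by
  refine ⟨hx, ?_⟩
  have hu0 : u ≠ 0 := fun h0 => by rw [h0, mink_zero_right] at h; exact lt_irrefl _ h
  by_contra hx0
  have h0 : (-x) ∈ H3 := by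
    refine ⟨by simpa [mink_neg_left, mink_neg_right] using hx, ?_⟩
    rcases (not_lt.1 hx0).lt_or_eq with h0 | h0
    · simpa using h0
    · exfalso
      simp only [mink, h0] at hx
      nlinarith [sq_nonneg (x 1), sq_nonneg (x 2), sq_nonneg (x 3)]
  have := mink_neg_of_mem_H3 h0 hu hu0
  rw [mink_neg_left] at this
  linarith

theorem one_le_neg_mink {x y : V} (hx : x ∈ H3) (hy : y ∈ H3) : 1 ≤ -mink x y := by
  obtain ⟨hx, hx0⟩ := hx
  obtain ⟨hy, hy0⟩ := hy
  simp only [mink] at *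
  have h1 : (1 + (x 1 * y 1 + x 2 * y 2 + x 3 * y 3)) ^ 2 ≤ (x 0 * y 0) ^ 2 := by
    have hx' : x 0 ^ 2 = 1 + x 1 ^ 2 + x 2 ^ 2 + x 3 ^ 2 := by linarith
    have hy' : y 0 ^ 2 = 1 + y 1 ^ 2 + y 2 ^ 2 + y 3 ^ 2 := by linarith
    rw [mul_pow, hx', hy']
    nlinarith [sq_nonneg (x 1 * y 2 - x 2 * y 1), sq_nonneg (x 1 * y 3 - x 3 * y 1),
      sq_nonneg (x 2 * y 3 - x 3 * y 2), sq_nonneg (x 1 - y 1), sq_nonneg (x 2 - y 2),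
      sq_nonneg (x 3 - y 3)]
  have h2 := le_abs_self (1 + (x 1 * y 1 + x 2 * y 2 + x 3 * y 3))
  have h3 := abs_le_of_sq_le_sq h1 (mul_pos hx0 hy0).le
  linarith

theorem eq_of_mink_eq {x y : V} (hx : x ∈ H3) (hy : y ∈ H3) (h : -mink x y = 1) : x = y := by
  obtain ⟨hx, hx0⟩ := hx
  obtain ⟨hy, hy0⟩ := hy
  simp only [mink] at *
  have hx' : x 0 ^ 2 = 1 + x 1 ^ 2 + x 2 ^ 2 + x 3 ^ 2 := by linarith
  have hy' : y 0 ^ 2 = 1 + y 1 ^ 2 + y 2 ^ 2 + y 3 ^ 2 := by linarith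
  have h0 : x 0 * y 0 = 1 + (x 1 * y 1 + x 2 * y 2 + x 3 * y 3) := by linarith
  have h1 : (x 1 - y 1) ^ 2 + (x 2 - y 2) ^ 2 + (x 3 - y 3) ^ 2 + ((x 1 * y 2 - x 2 * y 1) ^ 2 +
      (x 1 * y 3 - x 3 * y 1) ^ 2 + (x 2 * y 3 - x 3 * y 2) ^ 2) = 0 := by
    have h2 : x 0 ^ 2 * y 0 ^ 2 = (1 + (x 1 * y 1 + x 2 * y 2 + x 3 * y 3)) ^ 2 := by
      rw [← h0, mul_pow]
    rw [hx', hy'] at h2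
    linear_combination h2
  have hs1 := sq_nonneg (x 1 - y 1)
  have hs2 := sq_nonneg (x 2 - y 2)
  have hs3 := sq_nonneg (x 3 - y 3)
  have hs4 : 0 ≤ (x 1 * y 2 - x 2 * y 1) ^ 2 + (x 1 * y 3 - x 3 * y 1) ^ 2 +
    (x 2 * y 3 - x 3 * y 2) ^ 2 := by positivity
  have e1 : x 1 = y 1 := sub_eq_zero.1 (sq_eq_zero_iff.1 (by linarith))
  have e2 : x 2 = y 2 := sub_eq_zero.1 (sq_eq_zero_iff.1 (by linarith))
  have e3 : x 3 = y 3 := sub_eq_zero.1 (sq_eq_zero_iff.1 (by linarith))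
  refine vec_ext ?_ e1 e2 e3
  rw [← sq_eq_sq₀ hx0.le hy0.le, hx', hy', e1, e2, e3]

/-- A set `A` of ideal points of the hyperbolic plane on the negative side of the plane with unit
normal `m`, which is not orthogonal to the hyperbolic plane. -/
structure IsBase (m : V) (A : Set V) : Prop where
  unit : mink m m = 1
  pos : 0 < m 3
  null : ∀ v ∈ A, Null v
  neg : ∀ v ∈ A, mink m v < 0

namespace IsBase

variable {m m' : V} {A B : Set V}

theorem mono (h : IsBase m A) (hBA : B ⊆ A) : IsBase m B :=
  ⟨h.unit, h.pos, fun v hv => h.null v (hBA hv), fun v hv => h.neg v (hBA hv)⟩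

theorem causal (h : IsBase m A) {u : V} (hu : u ∈ cone A) : Causal u :=
  causal_of_mem_cone (fun v hv => (h.null v hv).causal) hu

theorem mink_nonpos (h : IsBase m A) {u : V} (hu : u ∈ cone A) : mink m u ≤ 0 := by
  have := mink_le_of_mem_cone (m := m) (m' := 0) (fun v hv => by
    rw [mink_zero_left]; exact (h.neg v hv).le) hu
  rwa [mink_zero_left] at this

theorem foot_eq (h : IsBase m A) {v : V} (hv : v ∈ A) : foot m v = (-mink m v)⁻¹ • v + m := by
  have hneg := h.neg v hv
  have e : -mink (v - mink v m • m) (v - mink v m • m) = mink m v ^ 2 := by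
    simp only [mink_sub_left, mink_sub_right, mink_smul_left, mink_smul_right, h.unit,
      (h.null v hv).self, mink_comm v m]
    ring
  rw [foot, e, Real.sqrt_sq_eq_abs, abs_of_neg hneg, mink_comm v m, smul_sub, smul_smul,
    sub_eq_add_neg, ← neg_smul, ← mul_neg, inv_mul_cancel₀ (by linarith), one_smul]

/-- A prism consists of the points `u + s • m` below the cone of its upper face. -/
theorem mem_prism_iff (h : IsBase m A) {p : V} : p ∈ prism m A ↔
    p ∈ H3 ∧ ∃ u ∈ cone A, ∃ s : ℝ, 0 ≤ s ∧ s ≤ -mink m u ∧ p = u + s • m := by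
  refine and_congr_right fun _ => ⟨fun hp => ?_, ?_⟩
  · refine cone_induction (A := A ∪ foot m '' A) (p := fun p => ∃ u ∈ cone A, ∃ s : ℝ, 0 ≤ s ∧
      s ≤ -mink m u ∧ p = u + s • m) ?_ ?_ ?_ ?_ hp
    · rintro v (hv | ⟨v, hv, rfl⟩)
      · exact ⟨v, subset_cone hv, 0, le_rfl, by linarith [h.neg v hv], by simp⟩
      · have hneg := neg_pos.2 (h.neg v hv)
        refine ⟨(-mink m v)⁻¹ • v, cone_smul (subset_cone hv) (inv_pos.2 hneg).le, 1, zero_le_one,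
          ?_, by rw [h.foot_eq hv, one_smul]⟩
        rw [mink_smul_right, ← mul_neg, inv_mul_cancel₀ hneg.ne']
    · exact ⟨0, zero_mem _, 0, le_rfl, by simp [mink_zero_right], by simp⟩
    · rintro x y ⟨u, hu, s, hs, hsu, rfl⟩ ⟨u', hu', s', hs', hsu', rfl⟩
      exact ⟨u + u', cone_add hu hu', s + s', add_nonneg hs hs', by rw [mink_add_right]; linarith,
        by module⟩
    · rintro c hc x ⟨u, hu, s, hs, hsu, rfl⟩
      refine ⟨c • u, cone_smul hu hc, c * s, mul_nonneg hc hs, ?_, by module⟩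
      rw [mink_smul_right, ← mul_neg]
      exact mul_le_mul_of_nonneg_left hsu hc
  · rintro ⟨u, hu, s, hs, hsu, rfl⟩
    have h1 : u ∈ cone (A ∪ foot m '' A) := cone_mono Set.subset_union_left hu
    have h2 : u + (-mink m u) • m ∈ cone (A ∪ foot m '' A) := by
      refine cone_induction (A := A) (p := fun u => u + (-mink m u) • m ∈ cone (A ∪ foot m '' A))
        ?_ ?_ ?_ ?_ hu
      · intro v hv
        have hneg := neg_pos.2 (h.neg v hv)
        have e : v + (-mink m v) • m = (-mink m v) • foot m v := by
          rw [h.foot_eq hv, smul_add, smul_inv_smul₀ hneg.ne']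
        rw [e]
        exact cone_smul (subset_cone (.inr ⟨v, hv, rfl⟩)) hneg.le
      · simp [mink_zero_right]
      · intro x y hx hy
        have := cone_add hx hy
        rw [mink_add_right]
        convert this using 1
        module
      · intro c hc x hx
        have := cone_smul hx hc
        rw [mink_smul_right]
        convert this using 1
        module
    change u + s • m ∈ cone (A ∪ foot m '' A)
    rcases (h.mink_nonpos hu).eq_or_lt with h0 | h0
    · have : s = 0 := le_antisymm (by linarith) hs
      simpa [this] using h1
    · have hU : 0 < -mink m u := neg_pos.2 h0
      -- The vector `u + (-mink m u) • m` is the orthogonal projection of `u` to the lower plane,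
      -- and the point lies between the two.
      have e : u + s • m = (1 - s / -mink m u) • u + (s / -mink m u) • (u + (-mink m u) • m) := by
        have : s = s / -mink m u * -mink m u := (div_mul_cancel₀ s hU.ne').symm
        conv_lhs => rw [this]
        module
      rw [e]
      exact cone_add (cone_smul h1 (sub_nonneg.2 ((div_le_one hU).2 hsu)))
        (cone_smul h2 (div_nonneg hs hU.le))

/-- Products of points depend on `m` only through the values `mink m u` and `mink m u'`, so equality
of these values preserves distances. -/
theorem mink_point (hm : mink m m = 1) (u u' : V) (s s' : ℝ) :
    mink (u + s • m) (u' + s' • m) = mink u u' + s' * mink m u + s * mink m u' + s * s' := by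
  simp only [mink_add_left, mink_add_right, mink_smul_left, mink_smul_right, hm, mink_comm u m]
  ring

theorem ne_zero (h : IsBase m A) {u : V} {s : ℝ} (hs : 0 ≤ s) (hsu : s ≤ -mink m u)
    (hp : u + s • m ∈ H3) : u ≠ 0 := by
  rintro rfl
  rw [mink_zero_right, neg_zero] at hsu
  have := hp.1
  rw [mink_point h.unit, le_antisymm hsu hs] at this
  simp [mink_zero_right] at this

/-- Points of different prisms that correspond to each other. -/
theorem transfer (h : IsBase m A) (h' : IsBase m' B) {u : V} {s : ℝ} (hu : u ∈ cone A)
    (hu' : u ∈ cone B) (hmu : mink m u = mink m' u) (hs : 0 ≤ s) (hsu : s ≤ -mink m u)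
    (hp : u + s • m ∈ H3) : u + s • m' ∈ prism m' B := by
  have hc := h.causal hu
  refine h'.mem_prism_iff.2 ⟨?_, u, hu', s, hs, by rwa [← hmu], rfl⟩
  refine mem_H3_of_mink_neg ?_ hc ?_
  · rw [mink_point h'.unit, ← hmu, ← mink_point h.unit, hp.1]
  · rw [mink_add_left, mink_smul_left, ← hmu, ← mink_smul_left, ← mink_add_left]
    exact mink_neg_of_mem_H3 hp hc (h.ne_zero hs hsu hp)

theorem height_eq (h : IsBase m A) {u : V} (hu : u ∈ cone A) (s : ℝ) :
    (u + s • m) 3 / m 3 = s := by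
  have := h.pos.ne'
  simp only [Pi.add_apply, Pi.smul_apply, smul_eq_mul, (h.causal hu).flat]
  field_simp
  ring

/-- The rotation about the edge that maps a lateral face to another one. -/
noncomputable def rotation (m m' p : V) : V := p + (p 3 / m 3) • (m' - m)

theorem rotation_point (h : IsBase m A) {u : V} (hu : u ∈ cone A) (s : ℝ) :
    rotation m m' (u + s • m) = u + s • m' := by
  rw [rotation, h.height_eq hu]; module

theorem rotation_mem (h : IsBase m A) (h' : IsBase m' A) (hmm : ∀ v ∈ A, mink m v = mink m' v)
    {p : V} (hp : p ∈ lateralFace m A) : rotation m m' p ∈ lateralFace m' A := by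
  obtain ⟨hH, u, hu, s, hs, hsu, rfl⟩ := h.mem_prism_iff.1 hp
  rw [h.rotation_point hu]
  exact h.transfer h' hu hu (mink_eq_of_mem_cone hmm hu) hs hsu hH

theorem rotation_rotation (h : IsBase m A) (h' : IsBase m' A) {p : V}
    (hp : p ∈ lateralFace m A) : rotation m' m (rotation m m' p) = p := by
  obtain ⟨hH, u, hu, s, hs, hsu, rfl⟩ := h.mem_prism_iff.1 hp
  rw [h.rotation_point hu, h'.rotation_point hu]

theorem lateralGlue (h : IsBase m A) (h' : IsBase m' A) (hmm : ∀ v ∈ A, mink m v = mink m' v)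
    {u : V} {s : ℝ} (hu : u ∈ cone A) (hp : u + s • m ∈ lateralFace m A) :
    LateralGlue A m m' (u + s • m) (u + s • m') := by
  refine ⟨⟨fun p => ⟨rotation m m' p, h.rotation_mem h' hmm p.2⟩,
    fun p => ⟨rotation m' m p, h'.rotation_mem h (fun v hv => (hmm v hv).symm) p.2⟩,
    fun p => Subtype.ext (h.rotation_rotation h' p.2),
    fun p => Subtype.ext (h'.rotation_rotation h p.2)⟩, ?_, ?_, hp, h.rotation_point hu s⟩
  · rintro ⟨p, hp⟩ ⟨q, hq⟩
    obtain ⟨-, u, hu, s, -, -, rfl⟩ := h.mem_prism_iff.1 hp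
    obtain ⟨-, u', hu', s', -, -, rfl⟩ := h.mem_prism_iff.1 hq
    change hdist (rotation m m' _) (rotation m m' _) = hdist _ _
    rw [h.rotation_point hu, h.rotation_point hu', hdist, hdist, mink_point h.unit,
      mink_point h'.unit, mink_eq_of_mem_cone hmm hu, mink_eq_of_mem_cone hmm hu']
  · rintro ⟨p, hp⟩ v hv
    change horoDist v (rotation m m' p) = horoDist v p
    rw [horoDist, horoDist, rotation, mink_add_left, mink_smul_left, mink_sub_left, hmm v hv,
      sub_self, mul_zero, add_zero]

/-- The gluing isometry of two lateral faces is unique. -/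
theorem eq_of_lateralGlue {a b : V} (h : IsBase m {a, b}) (h' : IsBase m' {a, b})
    (hab : mink a b < 0) (hmm : ∀ v ∈ ({a, b} : Set V), mink m v = mink m' v) {u : V} {s : ℝ}
    (hu : u ∈ cone {a, b}) (hs : 0 ≤ s) (hsu : s ≤ -mink m u) {y : V}
    (hg : LateralGlue {a, b} m m' (u + s • m) y) : y = u + s • m' := by
  obtain ⟨ψ, -, hψ, hx, rfl⟩ := hg
  have hyl := (ψ ⟨_, hx⟩).2
  have hhoro := hψ ⟨_, hx⟩
  generalize (ψ ⟨_, hx⟩ : V) = y at hyl hhoro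
  obtain ⟨hyH, u', hu', s', hs', hsu', rfl⟩ := h'.mem_prism_iff.1 hyl
  obtain ⟨hzH, -⟩ := h.transfer h' hu hu (mink_eq_of_mem_cone hmm hu) hs hsu hx.1
  rw [← sub_eq_zero]
  set d := u' + s' • m' - (u + s • m') with hd
  have hperp : ∀ v ∈ ({a, b} : Set V), mink d v = mink 0 v := by
    intro v hv
    have hvn := h.null v hv
    have h1 := Real.log_injOn_pos
      (show 0 < -mink (u' + s' • m') v from
        neg_pos.2 (mink_neg_of_mem_H3 hyH hvn.causal hvn.ne_zero))
      (show 0 < -mink (u + s • m) v from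
        neg_pos.2 (mink_neg_of_mem_H3 hx.1 hvn.causal hvn.ne_zero)) (hhoro v hv)
    rw [mink_add_left u, mink_smul_left s, hmm v hv, ← mink_smul_left, ← mink_add_left] at h1
    rw [hd, mink_sub_left, mink_zero_left]
    linarith
  have hcone : ∀ x ∈ cone {a, b}, mink d x = 0 := fun x hx => by
    rw [mink_eq_of_mem_cone hperp hx, mink_zero_left]
  have ht : Timelike (a + b) := (h.null a (by simp)).causal.add_timelike
    (h.null b (by simp)).causal hab
  refine eq_zero_of_mink_timelike ht ?_ (le_of_eq ?_)
  · rw [mink_comm]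
    exact hcone _ (cone_add (subset_cone (by simp)) (subset_cone (by simp)))
  have e1 : mink d (u' + s' • m') = -1 - mink (u' + s' • m') (u + s • m') := by
    rw [hd, mink_sub_left, hyH.1, mink_comm (u + s • m')]
  have e2 : mink d (u + s • m') = mink (u' + s' • m') (u + s • m') + 1 := by
    rw [hd, mink_sub_left, hzH.1]; ring
  -- The points with given distances to the two horospheres in the plane of the face are a point and
  -- its mirror image in the edge, whose heights are opposite. Here both heights are nonnegative,
  -- which excludes the mirror image.
  have e3 : (s + s') * mink d m' = 0 := by
    rw [mink_add_right, mink_smul_right, hcone u' hu'] at e1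
    rw [mink_add_right, mink_smul_right, hcone u hu] at e2
    linarith
  have e4 : mink d d = (s' - s) * mink d m' := by
    conv_lhs => rw [hd]
    rw [← hd, mink_sub_right, mink_add_right, mink_add_right, hcone u hu, hcone u' hu',
      mink_smul_right, mink_smul_right]
    ring
  rw [e4]
  rcases mul_eq_zero.1 e3 with h0 | h0
  · rw [show s = 0 by linarith, show s' = 0 by linarith]; ring
  · rw [h0, mul_zero]

end IsBase

/-! ### Coordinates on the complex and identified points -/

namespace CuspSurface

variable {n : ℕ} {S : CuspSurface n}

namespace Triangulation

variable {T T' : S.Triangulation} {r : Fin n → ℝ}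

namespace Admissible

theorem isBase (h : T.Admissible r) (Δ : T.faces) : IsBase (h.normal Δ) (Δ : Set V) :=
  ⟨h.normal_self Δ, h.normal_pos Δ, fun _ hv => null_of_lifts (lift_mem Δ.2 hv),
    (h.normal_spec Δ).1.side⟩

namespace Point

variable {h : T.Admissible r} {h' : T'.Admissible r}

/-- The coordinate of a point in the direction of the normal of the lower plane. -/
noncomputable def height (p : h.Point) : ℝ := p.pt 3 / h.normal p.face 3

/-- The projection of a point to the cone of the upper face. -/
noncomputable def base (p : h.Point) : V := p.pt - p.height • h.normal p.face

theorem pt_eq (p : h.Point) : p.pt = p.base + p.height • h.normal p.face := by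
  rw [base]; module

theorem mem_H3 (p : h.Point) : p.pt ∈ H3 := p.mem.1

theorem eq_of_pt_eq (p : h.Point) {u : V} {s : ℝ} (hu : u ∈ cone (p.face : Set V))
    (he : p.pt = u + s • h.normal p.face) : p.base = u ∧ p.height = s := by
  have hs : p.height = s := by rw [height, he, (h.isBase p.face).height_eq hu]
  exact ⟨by rw [base, hs, he]; module, hs⟩

theorem spec (p : h.Point) : p.base ∈ cone (p.face : Set V) ∧ 0 ≤ p.height ∧
    p.height ≤ -mink (h.normal p.face) p.base := by
  obtain ⟨-, u, hu, s, hs, hsu, he⟩ := (h.isBase p.face).mem_prism_iff.1 p.mem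
  obtain ⟨h1, h2⟩ := p.eq_of_pt_eq hu he
  rw [h1, h2]
  exact ⟨hu, hs, hsu⟩

theorem base_mem (p : h.Point) : p.base ∈ cone (p.face : Set V) := p.spec.1

theorem base_ne_zero (p : h.Point) : p.base ≠ 0 :=
  (h.isBase p.face).ne_zero p.spec.2.1 p.spec.2.2 (p.pt_eq ▸ p.mem_H3)

theorem ext_point {p q : h.Point} (hf : p.face = q.face) (hb : p.base = q.base)
    (hh : p.height = q.height) : p = q := by
  have hpt : p.pt = q.pt := by rw [p.pt_eq, q.pt_eq, hf, hb, hh]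
  obtain ⟨f, x, hx⟩ := p
  obtain ⟨f', x', hx'⟩ := q
  obtain rfl : f = f' := hf
  obtain rfl : x = x' := hpt
  rfl

/-- The corresponding point in another prism. -/
theorem exists_transfer (p : h.Point) (Δ : T'.faces) (hΔ : p.base ∈ cone (Δ : Set V))
    (hm : mink (h.normal p.face) p.base = mink (h'.normal Δ) p.base) :
    ∃ q : h'.Point, q.face = Δ ∧ q.base = p.base ∧ q.height = p.height := by
  have hq := (h.isBase p.face).transfer (h'.isBase Δ) p.base_mem hΔ hm p.spec.2.1 p.spec.2.2
    (p.pt_eq ▸ p.mem_H3)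
  exact ⟨⟨Δ, _, hq⟩, rfl, eq_of_pt_eq ⟨Δ, _, hq⟩ hΔ rfl⟩

theorem exists_translate (p : h.Point) {γ : V ≃ₗ[ℝ] V} (hγ : γ ∈ S.Γ) :
    ∃ q : h.Point, q.face = T.translate hγ p.face ∧ q.base = γ p.base ∧ q.height = p.height ∧
      h.toComplex q = h.toComplex p := by
  have hb : γ p.base ∈ cone ((T.translate hγ p.face : T.faces) : Set V) :=
    mem_cone_image γ p.base_mem
  have hpt : γ p.pt = γ p.base + p.height • h.normal (T.translate hγ p.face) := by
    rw [h.normal_translate, ← map_smul, ← map_add, ← p.pt_eq]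
  have hmem : γ p.pt ∈ prism (h.normal (T.translate hγ p.face))
      ((T.translate hγ p.face : T.faces) : Set V) := by
    refine (h.isBase _).mem_prism_iff.2 ⟨?_, γ p.base, hb, p.height, p.spec.2.1, ?_, hpt⟩
    · refine mem_H3_of_mink_neg (u := γ p.base) ?_ (causal_of_face (T.translate hγ p.face).2 hb) ?_
      · rw [S.mink_map γ hγ, p.mem_H3.1]
      · rw [S.mink_map γ hγ]
        exact mink_neg_of_mem_H3 p.mem_H3 (causal_of_face p.face.2 p.base_mem) p.base_ne_zero
    · rw [h.normal_translate, S.mink_map γ hγ]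
      exact p.spec.2.2
  obtain ⟨h1, h2⟩ := eq_of_pt_eq (h := h) ⟨T.translate hγ p.face, γ p.pt, hmem⟩ hb hpt
  exact ⟨⟨_, _, hmem⟩, rfl, h1, h2, (Quot.sound (Glue.deck p _ γ hγ rfl rfl)).symm⟩

end Point

/-- Adjacent triangles with a common vertex direction: corresponding points are identified. -/
theorem toComplex_eq_of_common (h : T.Admissible r) {p q : h.Point} {x : V} (hx : Timelike x)
    (hp : x ∈ cone (p.face : Set V)) (hq : x ∈ cone (q.face : Set V))
    (hu : p.base ∈ cone ((p.face : Set V) ∩ q.face)) (hb : p.base = q.base)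
    (hh : p.height = q.height) : h.toComplex p = h.toComplex q := by
  by_cases hf : p.face = q.face
  · rw [Point.ext_point hf hb hh]
  -- The vector `x` only shows that the triangles share an edge. The base of the points may be an
  -- ideal vertex of it.
  obtain ⟨a, b, c, d, he, hc, hd, htc, htd⟩ := exists_common_edge hx p.face.2 q.face.2
    (fun h => hf (Subtype.ext h)) hp hq
  rw [he] at hu
  have hep : {a, b} ⊆ (p.face : Set V) := he ▸ Set.inter_subset_left
  have heq : {a, b} ⊆ (q.face : Set V) := he ▸ Set.inter_subset_right
  have hBp := (h.isBase p.face).mono hep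
  refine Quot.sound (Glue.lateral p q hf {a, b} ?_ hep heq ?_)
  · exact Set.ncard_pair fun hab => by
      have := htc.ab; rw [hab, htc.nb.self] at this; exact lt_irrefl _ this
  · rw [p.pt_eq, q.pt_eq, ← hb, ← hh]
    exact hBp.lateralGlue ((h.isBase q.face).mono heq)
      (fun v hv => h.mink_normal_eq h p.face q.face (hep hv) (heq hv)) hu
      (hBp.mem_prism_iff.2 ⟨p.pt_eq ▸ p.mem_H3, p.base, hu, p.height, p.spec.2.1, p.spec.2.2, rfl⟩)

/-- Identified points have the same coordinates up to deck transformations. -/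
theorem exists_deck_of_toComplex_eq (h : T.Admissible r) {p q : h.Point}
    (hpq : h.toComplex p = h.toComplex q) :
    ∃ γ ∈ S.Γ, q.base = γ p.base ∧ q.height = p.height := by
  have hgen : Relation.EqvGen h.Glue p q := Quot.eqvGen_exact hpq
  clear hpq
  induction hgen with
  | rel p q hg =>
    cases hg with
    | deck γ hγ hface hpt =>
      have hface : q.face = T.translate hγ p.face := Subtype.ext hface
      refine ⟨γ, hγ, q.eq_of_pt_eq ?_ ?_⟩
      · rw [hface]; exact mem_cone_image γ p.base_mem
      · rw [hface, h.normal_translate, ← map_smul, ← map_add, ← p.pt_eq, hpt]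
    | lateral hne e he hp hq hpt =>
      refine ⟨1, one_mem _, ?_⟩
      obtain ⟨a, b, hab, rfl⟩ := Set.ncard_eq_two.1 he
      have hab' := mink_neg_of_lifts (lift_mem p.face.2 (hp (show a ∈ {a, b} by simp)))
        (lift_mem p.face.2 (hp (show b ∈ {a, b} by simp))) hab
      have hBp := (h.isBase p.face).mono hp
      have hx : p.pt ∈ lateralFace (h.normal p.face) {a, b} := hpt.choose_spec.2.2.choose
      obtain ⟨-, u, hu, s, hs, hsu, he⟩ := hBp.mem_prism_iff.1 hx
      obtain ⟨h1, h2⟩ := p.eq_of_pt_eq (cone_mono hp hu) he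
      rw [he] at hpt
      have := hBp.eq_of_lateralGlue ((h.isBase q.face).mono hq) hab'
        (fun v hv => h.mink_normal_eq h p.face q.face (hp hv) (hq hv)) hu hs hsu hpt
      rw [h1, h2]
      exact q.eq_of_pt_eq (cone_mono hq hu) this
  | refl p => exact ⟨1, one_mem _, rfl, rfl⟩
  | symm p q _ ih =>
    obtain ⟨γ, hγ, h1, h2⟩ := ih
    exact ⟨γ⁻¹, inv_mem hγ, by rw [h1, inv_apply_apply], h2.symm⟩
  | trans p q s _ _ ih ih' =>
    obtain ⟨γ, hγ, h1, h2⟩ := ih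
    obtain ⟨γ', hγ', h3, h4⟩ := ih'
    exact ⟨γ' * γ, mul_mem hγ' hγ, by rw [h3, h1]; rfl, h4.trans h2⟩

end Admissible

/-- Points with the same coordinates are identified. -/
theorem IsConvexPair.toComplex_eq (h : T.IsConvexPair r) {p q : h.admissible.Point}
    (hb : p.base = q.base) (hh : p.height = q.height) :
    h.admissible.toComplex p = h.admissible.toComplex q := by
  have hqb : p.base ∈ cone (q.face : Set V) := hb ▸ q.base_mem
  rcases (causal_of_face p.face.2 p.base_mem).timelike_or_null p.base_ne_zero with ht | hn
  · exact h.admissible.toComplex_eq_of_common ht p.base_mem hqb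
      (mem_cone_inter ht p.face.2 q.face.2 p.base_mem hqb) hb hh
  -- The points lie on lateral edges over the same ideal vertex `v`, but their triangles need not be
  -- adjacent. A path deep in the horoball at `v` connects them through triangles with vertex `v`,
  -- and the identification is carried along this path.
  obtain ⟨α, v, b, c, hα, hu, htri, hΔ⟩ := exists_vertex_of_null p.face.2 p.base_mem hn
  obtain ⟨α', v', b', c', hα', hu', htri', hΔ'⟩ := exists_vertex_of_null q.face.2 hqb hn
  have hvp : v ∈ (p.face : Set V) := by rw [hΔ]; simp
  have hvl : v ∈ S.lifts := lift_mem p.face.2 hvp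
  obtain rfl : v = v' := by
    refine eq_of_smul_of_lifts hvl (lift_mem q.face.2 (by rw [hΔ']; simp)) (c := α'⁻¹ * α) ?_
    rw [mul_smul, ← hu, hu', inv_smul_smul₀ hα'.ne']
  have hvq : v ∈ (q.face : Set V) := by rw [hΔ']; simp
  obtain ⟨κ, hκ, hdeep⟩ := T.exists_depth
  set x := v + b + c
  set y := v + b' + c'
  have hx : Timelike x := htri.timelike_sum
  have hy : Timelike y := htri'.timelike_sum
  have hxp : x ∈ cone (p.face : Set V) := by
    rw [hΔ]
    exact cone_add (cone_add (subset_cone (by simp)) (subset_cone (by simp)))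
      (subset_cone (by simp))
  have hyq : y ∈ cone (q.face : Set V) := by
    rw [hΔ']
    exact cone_add (cone_add (subset_cone (by simp)) (subset_cone (by simp)))
      (subset_cone (by simp))
  have hvn := null_of_lifts hvl
  have hGx := hx.mink_neg_of_causal hvn.causal hvn.ne_zero
  have hGy := hy.mink_neg_of_causal hvn.causal hvn.ne_zero
  -- This gives `-mink (z t) v ≤ κ * R` for all `t` in the unit interval, so `exists_depth` forces
  -- `v` to be a vertex along the whole path.
  set R := (-mink x v - mink y v) / κ
  have hR : 0 < R := div_pos (by linarith) hκ
  let z : ℝ → V := fun t => (1 - t) • x + t • y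
  let w : ℝ → V := fun t => z t + R • v
  have hwc : Continuous w := by fun_prop
  have hz : ∀ t ∈ Set.Icc (0 : ℝ) 1, Timelike (z t) := by
    rintro t ⟨h0, h1⟩
    rcases h1.lt_or_eq with h1 | rfl
    · exact (hx.smul (sub_pos.2 h1)).add_causal (hy.causal.smul h0)
    · simpa [z] using hy
  have hw : ∀ t ∈ Set.Icc (0 : ℝ) 1, Timelike (w t) := fun t ht =>
    (hz t ht).add_causal (hvn.causal.smul hR.le)
  have hvmem : ∀ t ∈ Set.Icc (0 : ℝ) 1, ∀ Δ ∈ T.faces, w t ∈ cone Δ → v ∈ Δ := by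
    intro t ht Δ hΔ hwΔ
    by_contra hvΔ
    have h1 := hdeep Δ hΔ _ hwΔ v hvl hvΔ
    have e1 : mink v (w t) = mink (z t) v := by
      simp only [w, mink_add_right, mink_smul_right, hvn.self, mink_comm v (z t)]; ring
    have e2 : mink (w t) (w t) = mink (z t) (z t) + 2 * R * mink (z t) v := by
      simp only [w, mink_add_right, mink_add_left, mink_smul_left, mink_smul_right, hvn.self,
        mink_comm v (z t)]
      ring
    have e3 : mink (z t) v = (1 - t) * mink x v + t * mink y v := by
      simp only [z, mink_add_left, mink_smul_left]
    have e4 : κ * R = -mink x v - mink y v := mul_div_cancel₀ _ hκ.ne'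
    have h2 := (hz t ht).mink_neg_of_causal hvn.causal hvn.ne_zero
    have h3 : -mink (z t) v ≤ κ * R := by
      rw [e3, e4]
      nlinarith [mul_nonneg ht.1 (neg_nonneg.2 hGx.le),
        mul_nonneg (sub_nonneg.2 ht.2) (neg_nonneg.2 hGy.le)]
    rw [e1, e2] at h1
    nlinarith [mul_pos hκ (neg_pos.2 (hz t ht).neg), mul_nonneg (neg_nonneg.2 h2.le)
      (sub_nonneg.2 h3), mul_pos (mul_pos hκ hR) (neg_pos.2 h2)]
  have hnear : ∀ t ∈ Set.Icc (0 : ℝ) 1, ∀ᶠ s in 𝓝 t, ∀ Δ ∈ T.faces, w s ∈ cone Δ → w t ∈ cone Δ :=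
    fun t ht => hwc.continuousAt.eventually (T.eventually_mem_cone (hw t ht))
  have hbase : ∀ (Δ Δ' : T.faces), v ∈ (Δ : Set V) → v ∈ (Δ' : Set V) →
      p.base ∈ cone ((Δ : Set V) ∩ Δ') := fun Δ Δ' h1 h2 => by
    rw [hu]; exact cone_smul (subset_cone (show v ∈ (Δ : Set V) ∩ Δ' from ⟨h1, h2⟩)) hα.le
  have main := real_induction (a := 0) (b := 1) (P := fun t => ∀ q : h.admissible.Point,
    w t ∈ cone (q.face : Set V) → p.base = q.base → p.height = q.height →
      h.admissible.toComplex p = h.admissible.toComplex q) ?_ ?_ ?_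
  · refine main 1 ⟨zero_le_one, le_rfl⟩ q ?_ hb hh
    simp only [w, z, sub_self, zero_smul, one_smul, zero_add]
    exact cone_add hyq (cone_smul (subset_cone hvq) hR.le)
  · intro q hq hb hh
    have h0 : w 0 ∈ cone (p.face : Set V) := by
      simp only [w, z, sub_zero, zero_smul, one_smul, add_zero]
      exact cone_add hxp (cone_smul (subset_cone hvp) hR.le)
    exact h.admissible.toComplex_eq_of_common (hw 0 ⟨le_rfl, zero_le_one⟩) h0 hq
      (hbase _ _ hvp (hvmem 0 ⟨le_rfl, zero_le_one⟩ _ q.face.2 hq)) hb hh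
  · intro t ht hP
    filter_upwards [(hnear t ⟨ht.1, ht.2.le⟩).filter_mono nhdsWithin_le_nhds] with s hs q hq
    exact hP q (hs _ q.face.2 hq)
  · intro t ht hP q hq hb hh
    have htI : t ∈ Set.Icc (0 : ℝ) 1 := ⟨ht.1.le, ht.2⟩
    obtain ⟨s, hs, hst⟩ := (((hnear t htI).filter_mono
      (nhdsWithin_le_nhds (s := Set.Iio t))).and (Ico_mem_nhdsLT ht.1)).exists
    have hsI : s ∈ Set.Icc (0 : ℝ) 1 := ⟨hst.1, hst.2.le.trans ht.2⟩
    obtain ⟨Δ, hΔ, hsΔ⟩ := T.exists_face (hw s hsI)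
    have hvΔ := hvmem s hsI Δ hΔ hsΔ
    have hpΔ : p.base ∈ cone Δ := by rw [hu]; exact cone_smul (subset_cone hvΔ) hα.le
    obtain ⟨q', hq', hb', hh'⟩ := p.exists_transfer (h' := h.admissible) ⟨Δ, hΔ⟩ hpΔ
      (h.mink_normal_eq h _ _ p.base_mem hpΔ)
    rw [hP s hst q' (by rw [hq']; exact hsΔ) hb'.symm hh'.symm]
    refine h.admissible.toComplex_eq_of_common (hw t htI) (by rw [hq']; exact hs Δ hΔ hsΔ) hq ?_
      (hb'.trans hb) (hh'.trans hh)
    rw [hb', hq']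
    exact hbase _ _ hvΔ (hvmem t htI _ q.face.2 hq)

end Triangulation

end CuspSurface

/-! ### Geodesics and the isometry of the complexes -/

/-- The unit speed geodesic between two points. -/
theorem exists_geodesic {p q : V} (hp : p ∈ H3) (hq : q ∈ H3) (hne : p ≠ q) :
    ∃ x : ℝ → V, Continuous x ∧ 0 < hdist p q ∧ x 0 = p ∧ x (hdist p q) = q ∧
      (∀ t ∈ Set.Icc 0 (hdist p q), x t ∈ H3 ∧ x t ∈ cone {p, q}) ∧
      ∀ t s, hdist (x t) (x s) = |t - s| := by
  have h1 : 1 < -mink p q := lt_of_le_of_ne (one_le_neg_mink hp hq)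
    fun h => hne (eq_of_mink_eq hp hq h.symm)
  set L := hdist p q with hL
  have hL0 : 0 < L := Real.arcosh_pos h1
  have hcosh : Real.cosh L = -mink p q := Real.cosh_arcosh h1.le
  have hsinh : 0 < Real.sinh L := Real.sinh_pos_iff.2 hL0
  set e := (Real.sinh L)⁻¹ • (q - Real.cosh L • p) with he
  have hpe : mink p e = 0 := by
    rw [he, mink_smul_right, mink_sub_right, mink_smul_right, hp.1, hcosh]; ring
  have hee : mink e e = 1 := by
    rw [he]
    simp only [mink_smul_left, mink_smul_right, mink_sub_left, mink_sub_right, hp.1, hq.1,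
      mink_comm q p]
    rw [show mink p q = -Real.cosh L by linarith]
    have := Real.cosh_sq L
    field_simp
    linarith
  let x : ℝ → V := fun t => Real.cosh t • p + Real.sinh t • e
  have hxx : ∀ t s, mink (x t) (x s) = -Real.cosh (t - s) := fun t s => by
    simp only [x, mink_add_left, mink_add_right, mink_smul_left, mink_smul_right, hp.1, hee, hpe,
      mink_comm e p, Real.cosh_sub]
    ring
  have hxe : ∀ t, x t = (Real.sinh (L - t) / Real.sinh L) • p + (Real.sinh t / Real.sinh L) • q :=
    fun t => by
      simp only [x, he, Real.sinh_sub]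
      match_scalars <;> field_simp
      ring
  have hpos : ∀ t ∈ Set.Icc 0 L, 0 ≤ Real.sinh (L - t) / Real.sinh L ∧
      0 ≤ Real.sinh t / Real.sinh L := fun t ht =>
    ⟨div_nonneg (Real.sinh_nonneg_iff.2 (sub_nonneg.2 ht.2)) hsinh.le,
      div_nonneg (Real.sinh_nonneg_iff.2 ht.1) hsinh.le⟩
  refine ⟨x, ?_, hL0, by simp [x], ?_, fun t ht => ⟨⟨by simp [hxx], ?_⟩, ?_⟩, fun t s => ?_⟩
  · exact ((Real.continuous_cosh.smul continuous_const).add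
      (Real.continuous_sinh.smul continuous_const))
  · rw [hxe, sub_self, Real.sinh_zero, div_self hsinh.ne']; simp
  · obtain ⟨hα, hβ⟩ := hpos t ht
    have h0 : 0 ≤ x t 0 := by
      rw [hxe]
      exact add_nonneg (mul_nonneg hα hp.2.le) (mul_nonneg hβ hq.2.le)
    refine lt_of_le_of_ne h0 fun h0 => ?_
    have := hxx t t
    rw [sub_self, Real.cosh_zero, mink, ← h0] at this
    nlinarith [sq_nonneg (x t 1), sq_nonneg (x t 2), sq_nonneg (x t 3)]
  · rw [hxe]
    exact cone_add (cone_smul (subset_cone (by simp)) (hpos t ht).1)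
      (cone_smul (subset_cone (by simp)) (hpos t ht).2)
  · rw [hdist, hxx, neg_neg, ← Real.cosh_abs, Real.arcosh_cosh (abs_nonneg _)]

/-- A curve that is locally nonexpanding is nonexpanding. -/
theorem edist_le_of_local {X : Type*} [PseudoEMetricSpace X] {L : ℝ} (hL : 0 ≤ L) (φ : ℝ → X)
    (h : ∀ t ∈ Set.Icc 0 L, ∀ᶠ s in 𝓝[Set.Icc 0 L] t, edist (φ t) (φ s) ≤ ENNReal.ofReal |t - s|) :
    edist (φ 0) (φ L) ≤ ENNReal.ofReal L := by
  refine real_induction (a := 0) (b := L) (P := fun t => edist (φ 0) (φ t) ≤ ENNReal.ofReal t)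
    (by simp) ?_ ?_ L ⟨hL, le_rfl⟩
  · intro t ht hP
    have h1 := (eventually_nhdsWithin_iff.1 (h t ⟨ht.1, ht.2.le⟩)).filter_mono
      (nhdsWithin_le_nhds (s := Set.Ioi t))
    filter_upwards [h1, Ioc_mem_nhdsGT ht.2] with s hs hst
    calc edist (φ 0) (φ s) ≤ edist (φ 0) (φ t) + edist (φ t) (φ s) := edist_triangle _ _ _
      _ ≤ ENNReal.ofReal t + ENNReal.ofReal |t - s| :=
        add_le_add hP (hs ⟨ht.1.trans hst.1.le, hst.2⟩)
      _ = ENNReal.ofReal s := by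
        rw [← ENNReal.ofReal_add ht.1 (abs_nonneg _), abs_sub_comm,
          abs_of_pos (sub_pos.2 hst.1), add_sub_cancel]
  · intro t ht hP
    have h1 := (eventually_nhdsWithin_iff.1 (h t ⟨ht.1.le, ht.2⟩)).filter_mono
      (nhdsWithin_le_nhds (s := Set.Iio t))
    obtain ⟨s, hs, hst⟩ := (h1.and (Ico_mem_nhdsLT ht.1)).exists
    calc edist (φ 0) (φ t) ≤ edist (φ 0) (φ s) + edist (φ s) (φ t) := edist_triangle _ _ _
      _ ≤ ENNReal.ofReal s + ENNReal.ofReal |t - s| := by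
        rw [edist_comm (φ s)]
        exact add_le_add (hP s hst) (hs ⟨hst.1, hst.2.le.trans ht.2⟩)
      _ = ENNReal.ofReal t := by
        rw [← ENNReal.ofReal_add hst.1 (abs_nonneg _), abs_of_pos (sub_pos.2 hst.2),
          add_sub_cancel]

namespace CuspSurface

variable {n : ℕ} {S : CuspSurface n}

namespace Triangulation

variable {T T' : S.Triangulation} {r : Fin n → ℝ}

theorem Admissible.edist_toComplex_le (h : T.Admissible r) {p q : h.Point} (hf : p.face = q.face) :
    edist (h.toComplex p) (h.toComplex q) ≤ ENNReal.ofReal (hdist p.pt q.pt) := by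
  have h1 : h.data.Chain (h.toComplex p) (h.toComplex q) (h.data.d p q + 0) :=
    GluingData.Chain.cons (G := h.data) p q _ 0 (GluingData.Chain.nil _)
  have h2 : h.data.d p q = ENNReal.ofReal (hdist p.pt q.pt) := if_pos hf
  rw [h2, add_zero] at h1
  exact sInf_le h1

namespace IsConvexPair

/-- The point with the same coordinates in the other complex. -/
theorem exists_point (h : T.IsConvexPair r) (h' : T'.IsConvexPair r) (p : h.admissible.Point) :
    ∃ q : h'.admissible.Point, q.base = p.base ∧ q.height = p.height := by
  obtain ⟨Δ', hΔ', hn⟩ := h.exists_same_normal h' p.face p.base_mem p.base_ne_zero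
  obtain ⟨q, -, hq⟩ := p.exists_transfer (h' := h'.admissible) Δ' hΔ' (by rw [hn])
  exact ⟨q, hq⟩

/-- The geodesic segment from `p` to `q` is transported to the other complex. Near each time it
stays in prisms of `T'` with the same normal, where it keeps its length, so `edist_le_of_local`
applies. -/
theorem edist_le (h : T.IsConvexPair r) (h' : T'.IsConvexPair r) {p q : h.admissible.Point}
    (hf : p.face = q.face) {p' q' : h'.admissible.Point} (hpb : p'.base = p.base)
    (hph : p'.height = p.height) (hqb : q'.base = q.base) (hqh : q'.height = q.height) :
    edist (h'.admissible.toComplex p') (h'.admissible.toComplex q') ≤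
      ENNReal.ofReal (hdist p.pt q.pt) := by
  have hext : ∀ a b : h.admissible.Point, a.face = b.face → a.pt = b.pt → a = b := by
    rintro ⟨f, x, hx⟩ ⟨f', x', hx'⟩ hab hpt
    obtain rfl : f = f' := hab
    obtain rfl : x = x' := hpt
    rfl
  by_cases hpq : p.pt = q.pt
  · obtain rfl := hext p q hf hpq
    rw [h'.toComplex_eq (hpb.trans hqb.symm) (hph.trans hqh.symm), edist_self]
    exact bot_le
  obtain ⟨x, hxc, hL, hx0, hxL, hxm, hxd⟩ := exists_geodesic p.mem_H3 q.mem_H3 hpq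
  set L := hdist p.pt q.pt
  have hpath : ∀ t ∈ Set.Icc 0 L, ∃ a : h.admissible.Point, a.face = p.face ∧ a.pt = x t :=
    fun t ht => ⟨⟨p.face, x t, (hxm t ht).1, (Submodule.span_le (R := ℝ≥0)).2 (by
      rintro y (rfl | rfl)
      · exact p.mem.2
      · rw [hf]; exact q.mem.2) (hxm t ht).2⟩, rfl, rfl⟩
  have : Nonempty h.admissible.Point := ⟨p⟩
  choose! f hff hfx using hpath
  choose g hgb hgh using h.exists_point h'
  set m := h.admissible.normal p.face with hm
  let b : ℝ → V := fun t => x t - (x t 3 / m 3) • m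
  have hbc : Continuous b := by fun_prop
  have hfb : ∀ t ∈ Set.Icc 0 L, (f t).base = b t := fun t ht => by
    simp only [b, Admissible.Point.base, Admissible.Point.height, hff t ht, hfx t ht, hm]
  have hbm : ∀ t ∈ Set.Icc 0 L, b t ∈ cone (p.face : Set V) := fun t ht => by
    rw [← hfb t ht, ← hff t ht]; exact (f t).base_mem
  have hb0 : ∀ t ∈ Set.Icc 0 L, b t ≠ 0 := fun t ht => by
    rw [← hfb t ht]; exact (f t).base_ne_zero
  have hlocal : ∀ t ∈ Set.Icc 0 L, ∀ᶠ s in 𝓝[Set.Icc 0 L] t,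
      edist (h'.admissible.toComplex (g (f t))) (h'.admissible.toComplex (g (f s))) ≤
        ENNReal.ofReal |t - s| := by
    intro t ht
    have htend : Filter.Tendsto b (𝓝[Set.Icc 0 L] t) (𝓝[cone (p.face : Set V)] (b t)) :=
      tendsto_nhdsWithin_iff.2 ⟨hbc.continuousAt.tendsto.mono_left nhdsWithin_le_nhds,
        eventually_mem_nhdsWithin.mono hbm⟩
    filter_upwards [htend.eventually
      (T'.eventually_mem_cone_within p.face.2 (hbm t ht) (hb0 t ht)), self_mem_nhdsWithin]
      with s hs hsI
    -- The triangle is chosen at time `s`. For `s` near `t` it also contains the base at time `t`,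
    -- so both points lie in one prism over `T'`.
    obtain ⟨Δ', hΔ', hn⟩ := h.exists_same_normal h' p.face (hbm s hsI) (hb0 s hsI)
    have htΔ' := hs Δ' Δ'.2 hΔ'
    have key : ∀ τ ∈ Set.Icc 0 L, b τ ∈ cone (Δ' : Set V) → ∃ a : h'.admissible.Point,
        a.face = Δ' ∧ a.pt = x τ ∧
          h'.admissible.toComplex (g (f τ)) = h'.admissible.toComplex a := fun τ hτ hbτ => by
      obtain ⟨a, ha, hab, hah⟩ := (f τ).exists_transfer (h' := h'.admissible) Δ'
        (by rwa [hfb τ hτ]) (by rw [hn, hff τ hτ])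
      refine ⟨a, ha, ?_, h'.toComplex_eq ((hgb _).trans hab.symm) ((hgh _).trans hah.symm)⟩
      rw [← hfx τ hτ, a.pt_eq, (f τ).pt_eq, hab, hah, ha, hn, hff τ hτ]
    obtain ⟨a, haf, hax, ha⟩ := key t ht htΔ'
    obtain ⟨c, hcf, hcx, hc⟩ := key s hsI hΔ'
    rw [ha, hc, ← hxd, ← hax, ← hcx]
    exact h'.admissible.edist_toComplex_le (haf.trans hcf.symm)
  have hfin := edist_le_of_local hL.le (fun t => h'.admissible.toComplex (g (f t))) hlocal
  have hI0 : (0 : ℝ) ∈ Set.Icc 0 L := ⟨le_rfl, hL.le⟩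
  have hIL : L ∈ Set.Icc 0 L := ⟨hL.le, le_rfl⟩
  have e0 : f 0 = p := hext _ _ (hff 0 hI0) ((hfx 0 hI0).trans hx0)
  have eL : f L = q := hext _ _ ((hff L hIL).trans hf) ((hfx L hIL).trans hxL)
  rwa [e0, eL, h'.toComplex_eq ((hgb p).trans hpb.symm) ((hgh p).trans hph.symm),
    h'.toComplex_eq ((hgb q).trans hqb.symm) ((hgh q).trans hqh.symm)] at hfin

/-- Two points of the complexes of two convex pairs correspond to each other if they have the same
coordinates. -/
def Corresponds (h : T.IsConvexPair r) (h' : T'.IsConvexPair r) (k : h.admissible.Complex)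
    (k' : h'.admissible.Complex) : Prop :=
  ∃ (p : h.admissible.Point) (p' : h'.admissible.Point), h.admissible.toComplex p = k ∧
    h'.admissible.toComplex p' = k' ∧ p'.base = p.base ∧ p'.height = p.height

variable {h : T.IsConvexPair r} {h' : T'.IsConvexPair r}

theorem Corresponds.symm {k : h.admissible.Complex} {k' : h'.admissible.Complex}
    (hk : Corresponds h h' k k') : Corresponds h' h k' k := by
  obtain ⟨p, p', h1, h2, h3, h4⟩ := hk
  exact ⟨p', p, h2, h1, h3.symm, h4.symm⟩

/-- Representatives of `k` differ by a deck transformation in their coordinates. Translating by it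
does not change a point of the other complex. -/
theorem Corresponds.unique {k : h.admissible.Complex} {k₁ k₂ : h'.admissible.Complex}
    (h₁ : Corresponds h h' k k₁) (h₂ : Corresponds h h' k k₂) : k₁ = k₂ := by
  obtain ⟨p₁, q₁, hp₁, rfl, hb₁, hh₁⟩ := h₁
  obtain ⟨p₂, q₂, hp₂, rfl, hb₂, hh₂⟩ := h₂
  obtain ⟨γ, hγ, hb, hh⟩ := h.admissible.exists_deck_of_toComplex_eq (hp₁.trans hp₂.symm)
  obtain ⟨q, -, hqb, hqh, hq⟩ := q₁.exists_translate hγ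
  rw [← hq]
  exact h'.toComplex_eq (by rw [hqb, hb₁, hb₂, hb]) (by rw [hqh, hh₁, hh₂, hh])

theorem exists_corresponds (h : T.IsConvexPair r) (h' : T'.IsConvexPair r)
    (k : h.admissible.Complex) : ∃ k' : h'.admissible.Complex, Corresponds h h' k k' := by
  obtain ⟨p, rfl⟩ := Quot.exists_rep k
  obtain ⟨q, hq⟩ := h.exists_point h' p
  exact ⟨_, p, q, rfl, rfl, hq⟩

/-- Chains are transported link by link. A link between different prisms has length `⊤` and needs no
estimate. -/
theorem Corresponds.edist_le {k l : h.admissible.Complex} {k' l' : h'.admissible.Complex}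
    (hk : Corresponds h h' k k') (hl : Corresponds h h' l l') : edist k' l' ≤ edist k l := by
  have key : ∀ (k l : h.admissible.data.Space) (M : ℝ≥0∞), h.admissible.data.Chain k l M →
      ∀ k' l' : h'.admissible.Complex, Corresponds h h' k k' → Corresponds h h' l l' →
        edist k' l' ≤ M := by
    intro k l M hM
    induction hM with
    | nil k =>
      intro k' l' hk hl
      rw [hk.unique hl, edist_self]
    | cons p q l M hM ih =>
      intro k' l' hk hl
      by_cases hf : p.face = q.face
      · obtain ⟨p', hpb, hph⟩ := h.exists_point h' p
        obtain ⟨q', hqb, hqh⟩ := h.exists_point h' q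
        have h1 := ih (h'.admissible.toComplex q') l' ⟨q, q', rfl, rfl, hqb, hqh⟩ hl
        have h2 : h'.admissible.toComplex p' = k' :=
          Corresponds.unique ⟨p, p', rfl, rfl, hpb, hph⟩ hk
        have h3 : h.admissible.data.d p q = ENNReal.ofReal (hdist p.pt q.pt) := if_pos hf
        rw [h3, ← h2]
        exact (edist_triangle _ _ _).trans (add_le_add (h.edist_le h' hf hpb hph hqb hqh) h1)
      · have h3 : h.admissible.data.d p q = ⊤ := if_neg hf
        rw [h3, top_add]
        exact le_top
  exact le_sInf fun M hM => key k l M hM k' l' hk hl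

theorem Corresponds.edist_eq {k l : h.admissible.Complex} {k' l' : h'.admissible.Complex}
    (hk : Corresponds h h' k k') (hl : Corresponds h h' l l') : edist k' l' = edist k l :=
  le_antisymm (hk.edist_le hl) (hk.symm.edist_le hl.symm)

/-- The complexes of two convex pairs with the same weights are isometric. -/
theorem exists_isometry (h : T.IsConvexPair r) (h' : T'.IsConvexPair r) :
    ∃ Φ : h.admissible.Complex ≃ᵢ h'.admissible.Complex, ∀ k, Corresponds h h' k (Φ k) := by
  choose F hF using exists_corresponds h h'
  choose G hG using exists_corresponds h' h
  exact ⟨⟨⟨F, G, fun k => (hG (F k)).unique (hF k).symm, fun k => (hF (G k)).unique (hG k).symm⟩,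
    fun k l => (hF k).edist_eq (hF l)⟩, hF⟩

end IsConvexPair

/-! ### The marking by the surface -/

theorem proj_eq_iff {x y : H2} (h : S.proj x = S.proj y) : ∃ γ ∈ S.Γ, γ (x : V) = y := by
  have hgen : Relation.EqvGen S.surfaceData.rel x y := Quot.eqvGen_exact h
  clear h
  induction hgen with
  | rel x y h => exact h
  | refl x => exact ⟨1, one_mem _, rfl⟩
  | symm x y _ ih =>
    obtain ⟨γ, hγ, e⟩ := ih
    exact ⟨γ⁻¹, inv_mem hγ, by rw [← e, inv_apply_apply]⟩
  | trans x y z _ _ ih ih' =>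
    obtain ⟨γ, hγ, e⟩ := ih
    obtain ⟨γ', hγ', e'⟩ := ih'
    exact ⟨γ' * γ, mul_mem hγ' hγ, by rw [← e', ← e]; rfl⟩

theorem _root_.Prismatic.CuspSurface.isotopicToId_refl (S : CuspSurface n) :
    S.IsotopicToId (IsometryEquiv.refl S.Surface) :=
  ⟨fun _ => Homeomorph.refl _, continuous_snd, fun _ _ => Filter.tendsto_id, fun _ => rfl,
    fun _ => rfl⟩

end Triangulation

end CuspSurface

end Prismatic

theorem lemma4p1 {n : ℕ} (S : Prismatic.CuspSurface n) (T' T'' : S.Triangulation)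
    (r : Fin n → ℝ) (h' : T'.IsConvexPair r) (h'' : T''.IsConvexPair r) :
    Prismatic.CuspSurface.Triangulation.MarkedIsometric h'.admissible h''.admissible := by
  obtain ⟨Φ, hΦ⟩ := h'.exists_isometry h''
  refine ⟨Φ, IsometryEquiv.refl _, S.isotopicToId_refl, ?_⟩
  rintro s _ _ ⟨x, p, hx, hpx, hs, rfl⟩ ⟨y, q, hy, hqy, hs', rfl⟩
  obtain ⟨γ, hγ, hγx⟩ := Prismatic.CuspSurface.Triangulation.proj_eq_iff (hs.trans hs'.symm)
  -- Upper boundary points have height `0` and are their own base, so `Φ` induces the identity on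
  -- the surface.
  obtain ⟨hpb, hph⟩ := p.eq_of_pt_eq (u := x) (s := 0) hx.2 (by rw [hpx, zero_smul, add_zero])
  obtain ⟨hqb, hqh⟩ := q.eq_of_pt_eq (u := y) (s := 0) hy.2 (by rw [hqy, zero_smul, add_zero])
  obtain ⟨p', -, hpb', hph', hp'⟩ := p.exists_translate hγ
  refine (hΦ _).unique ⟨p', q, hp', rfl, ?_, ?_⟩
  · rw [hqb, hpb', hpb, hγx]
  · rw [hqh, hph', hph]
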